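/- Let $P=(X,\prec)$ be a finite poset with $|X|=n$ elements. For $x\in X$ let $b(x)=|\{y\in X : y\succcurlyeq x\}|$, and let $e(P)$ be the number of linear extensions of $P$, i.e. of bijections $f:X\to\{1,\dots,n\}$ such that $f(x)<f(y)$ whenever $x\prec y$. Then the function $$\xi(P)\;=\;e(P)\cdot\prod_{x\in X}b(x)\;-\;n!$$ takes values in $\mathbb N=\{0,1,2,\dots\}$ and, as a function of $P$, lies in the counting class $\mathsf{\#P}$. Here $P$ is given to the machine as a binary string: for a listing $x_1,\dots,x_n$ of $X$ (any listing is allowed), the number $n$ in unary, followed by a $0$, followed by the rows of the $n\times n$ matrix of zeros and ones whose $(i,j)$ entry is $1$ if and only if $x_i\preccurlyeq x_j$; on strings that do not encode a poset the function is $0$. A function $F:\{0,1\}^*\to\mathbb N$ is in $\mathsf{\#P}$ if there are a polynomial $p$ and a relation $V\subseteq\{0,1\}^*\times\{0,1\}^*$ decidable by a Turing machine in polynomial time such that $F(w)=|\{y\in\{0,1\}^{p(|w|)} : (w,y)\in V\}|$ for all $w$. -/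

import Mathlib

open scoped Nat

/-! ### Finite posets and the function `ξ` -/

/-- The number `e(P)` of linear extensions of a finite poset `P = (X, ≺)` with `n` elements: the
number of bijections `f : X → [n]` such that `f x < f y` whenever `x ≺ y`. The `n`-element chain
`[n] = {1 < ⋯ < n}` is `Fin n`. -/
noncomputable def numLinExt (X : Type) [PartialOrder X] [Fintype X] : ℕ :=
  Nat.card {f : X ≃ Fin (Fintype.card X) // ∀ x y : X, x < y → f x < f y}

/-- The size `b(x)` of the upper order ideal `B(x) = {y : y ≽ x}`. -/
noncomputable def upperCard {X : Type} [PartialOrder X] (x : X) : ℕ :=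
  Nat.card {y : X // x ≤ y}

/-- `ξ(P) = e(P) · ∏_{x ∈ X} b(x) - n!`, with the subtraction carried out in `ℤ`. -/
noncomputable def xi (X : Type) [PartialOrder X] [Fintype X] : ℤ :=
  ((numLinExt X * ∏ x : X, upperCard x : ℕ) : ℤ) - ((Fintype.card X)! : ℤ)

open Classical in
/-- The binary encoding of a finite poset whose elements have been listed as `x_0, …, x_{n-1}` by
`ε : X ≃ Fin n`: the number `n` in unary (`1ⁿ0`), followed by the rows of the `n × n` matrix whose
`(i, j)` entry says whether `x_i ≼ x_j`. -/
noncomputable def encodePoset {X : Type} [PartialOrder X] {n : ℕ} (ε : X ≃ Fin n) : List Bool :=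
  List.replicate n true ++ false ::
    (List.finRange n).flatMap fun i =>
      (List.finRange n).map fun j => decide (ε.symm i ≤ ε.symm j)

/-- `w` is the binary encoding of some finite poset. -/
def IsPosetCode (w : List Bool) : Prop :=
  ∃ (X : Type) (_ : PartialOrder X) (n : ℕ) (ε : X ≃ Fin n), w = encodePoset ε

/-! ### The class #P -/

/-- A pair `(x, y)` of binary strings as the single string `x # y` over the alphabet `{0, 1, #}`;
the separator `#` is `none`. -/
def encodePair (p : List Bool × List Bool) : List (Option Bool) :=
  p.1.map some ++ none :: p.2.map some

/-- The binary relation `V` on binary strings is decided by a (multi-tape) Turing machine in time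
polynomial in the length of the input. -/
def PolyTimeDecidable (V : List Bool → List Bool → Bool) : Prop :=
  Nonempty (Turing.TM2ComputableInPolyTime encodePair Computability.encodeBool
    fun p : List Bool × List Bool => V p.1 p.2)

/-- `F : {0,1}* → ℕ` is in #P: there are a polynomial `p` and a polynomial-time decidable relation
`V` such that `F x` is the number of strings `y` of length `p(|x|)` with `V x y`. -/
def InSharpP (F : List Bool → ℕ) : Prop :=
  ∃ (p : Polynomial ℕ) (V : List Bool → List Bool → Bool), PolyTimeDecidable V ∧
    ∀ x : List Bool, F x = {y : List Bool | y.length = p.eval x.length ∧ V x y = true}.ncard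

/-! ### Structured programs for counter machines with a two-way input tape -/

namespace CounterMachine

open Turing Function

/-! Run the following procedure on the poset. While a set `R` of elements remains, pick any y in
`R`, let m be the minimal element of `R` below y that comes first in the listing, record the pair
(m, y), and delete m. With k elements left there are k choices of y, and y determines m, so there
are n! possible records (`LinExt.card_isGood`).

In every record the elements m form a linear extension, and each y lies above its m. Linear
extensions with an arbitrary upper bound chosen for every element number e(P) · ∏ b(x)
(`LinExt.card_isExt`). Hence ξ(P) counts those that are not records. By `LinExt.isGood_iff` these
are exactly the ones with a defect: at some step, a minimal remaining element below y precedes m in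
the listing. So ξ(P) ≥ 0, and a linear extension with upper bounds and a defect is a certificate
(`LinExt.ncard_isExt_defect`).

For membership in #P, a certificate is written as two n × n matrices, the graphs of t ↦ m and t ↦ y,
padded with zeros to length 2|x|, so that each certificate is exactly one string. The verifier is a
first-order formula about bits of the two strings whose quantifiers range over numbers bounded by
the string lengths. Such formulas are decided in polynomial time by machines with unary counters:
the class `Comp` is closed under arithmetic, bit lookup and bounded sums, hence `CompPred` under
bounded quantifiers, and its programs compile to stack machines. -/

/-- The stacks of the machine: the part of the input to the right of the head, the part to its
left, the output, and `r` unary counters. -/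
inductive Reg (r : ℕ)
  | right
  | left
  | out
  | cnt (i : Fin r)
  deriving DecidableEq, Fintype

/-- The stack alphabets. -/
@[reducible] def Reg.Alphabet {r : ℕ} : Reg r → Type
  | .right => Option Bool
  | .left => Option Bool
  | .out => Bool
  | .cnt _ => Unit

/-- The finite control stores at most one input symbol. -/
abbrev Control := Option (Option Bool)

/-- Statements of the underlying stack machine. -/
abbrev Code (r : ℕ) (Λ : Type) := TM2.Stmt (Reg.Alphabet (r := r)) Λ Control

/-- Configurations of the underlying stack machine. -/
abbrev Config (r : ℕ) (Λ : Type) := TM2.Cfg (Reg.Alphabet (r := r)) Λ Control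

/-- A memory state: the input to the left of the head (reversed), the input to the right of the
head, and the values of the counters. -/
structure Mem where
  left : List (Option Bool)
  right : List (Option Bool)
  cnt : ℕ → ℕ

/-- The stacks that represent a memory state. -/
def Mem.stk (s : Mem) {r : ℕ} : ∀ k : Reg r, List k.Alphabet
  | .right => s.right
  | .left => s.left
  | .out => []
  | .cnt i => List.replicate (s.cnt i) ()

/-- Elementary instructions. -/
inductive Instr
  | inc (i : ℕ)
  | dec (i : ℕ)
  | moveRight
  | moveLeft
  | drop

namespace Instr

/-- The counters mentioned by an instruction exist. -/
def Fits (r : ℕ) : Instr → Prop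
  | inc i => i < r
  | dec i => i < r
  | _ => True

/-- The effect of an instruction. -/
def eval : Instr → Mem → Mem
  | inc i, s => ⟨s.left, s.right, update s.cnt i (s.cnt i + 1)⟩
  | dec i, s => ⟨s.left, s.right, update s.cnt i (s.cnt i - 1)⟩
  | moveRight, ⟨l, a :: r, c⟩ => ⟨a :: l, r, c⟩
  | moveRight, ⟨l, [], c⟩ => ⟨l, [], c⟩
  | moveLeft, ⟨a :: l, r, c⟩ => ⟨l, a :: r, c⟩
  | moveLeft, ⟨[], r, c⟩ => ⟨[], r, c⟩
  | drop, s => ⟨s.left, s.right.tail, s.cnt⟩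

/-- The code of an instruction. -/
def code (r : ℕ) {Λ : Type} (next : Λ) : Instr → Code r Λ
  | inc i => if h : i < r then .push (.cnt ⟨i, h⟩) (fun _ => ()) (.goto fun _ => next)
      else .halt
  | dec i => if h : i < r then .pop (.cnt ⟨i, h⟩) (fun v _ => v) (.goto fun _ => next)
      else .halt
  | moveRight => .pop .right (fun _ o => o) (.branch Option.isSome
      (.push .left (fun v => v.getD none) (.load (fun _ => none) (.goto fun _ => next)))
      (.goto fun _ => next))
  | moveLeft => .pop .left (fun _ o => o) (.branch Option.isSome
      (.push .right (fun v => v.getD none) (.load (fun _ => none) (.goto fun _ => next)))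
      (.goto fun _ => next))
  | drop => .pop .right (fun v _ => v) (.goto fun _ => next)

/-- Each instruction leaves the control empty, so fragments can be chained without tracking it. -/
theorem stepAux_code {r : ℕ} {Λ : Type} (next : Λ) (p : Instr) (hp : p.Fits r) (s : Mem) :
    TM2.stepAux (p.code r next) none s.stk = ⟨some next, none, (p.eval s).stk⟩ := by
  cases p with
  | inc i =>
    have hi : i < r := hp
    simp only [code, hi, dif_pos, TM2.stepAux, eval]
    congr 1
    funext k
    rcases k with _ | _ | _ | k <;> simp [Mem.stk]
    by_cases hk : k = ⟨i, hi⟩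
    · subst hk; simp [List.replicate_succ]
    · have : (k : ℕ) ≠ i := fun h => hk (Fin.ext h)
      simp [hk, Mem.stk, this]
  | dec i =>
    have hi : i < r := hp
    simp only [code, hi, dif_pos, TM2.stepAux, eval]
    congr 1
    funext k
    rcases k with _ | _ | _ | k <;> simp [Mem.stk]
    by_cases hk : k = ⟨i, hi⟩
    · subst hk; simp
    · have : (k : ℕ) ≠ i := fun h => hk (Fin.ext h)
      simp [hk, Mem.stk, this]
  | moveRight =>
    obtain ⟨l, _ | ⟨a, w⟩, c⟩ := s <;>
    · simp only [code, TM2.stepAux, eval, Mem.stk, List.head?, Option.isSome, cond]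
      congr 1
      funext k
      rcases k with _ | _ | _ | k <;> simp [Mem.stk]
  | moveLeft =>
    obtain ⟨_ | ⟨a, w⟩, l, c⟩ := s <;>
    · simp only [code, TM2.stepAux, eval, Mem.stk, List.head?, Option.isSome, cond]
      congr 1
      funext k
      rcases k with _ | _ | _ | k <;> simp [Mem.stk]
  | drop =>
    simp only [code, TM2.stepAux, eval]
    congr 1
    funext k
    rcases k with _ | _ | _ | k <;> simp [Mem.stk]

end Instr

/-- Tests. -/
inductive Test
  | nonzero (i : ℕ)
  | symbol (a : Option Bool)
  | moreRight
  | moreLeft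

namespace Test

/-- The counters mentioned by a test exist. -/
def Fits (r : ℕ) : Test → Prop
  | nonzero i => i < r
  | _ => True

/-- The outcome of a test. -/
def eval : Test → Mem → Bool
  | nonzero i, s => s.cnt i != 0
  | symbol a, s => s.right.head? == some a
  | moreRight, s => !s.right.isEmpty
  | moreLeft, s => !s.left.isEmpty

/-- The code of a test with its two continuations. -/
def code (r : ℕ) {Λ : Type} (yes no : Λ) : Test → Code r Λ
  | nonzero i => if h : i < r then
      .peek (.cnt ⟨i, h⟩) (fun _ o => o.map fun _ => none) (.branch Option.isSome
        (.load (fun _ => none) (.goto fun _ => yes)) (.load (fun _ => none) (.goto fun _ => no)))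
      else .halt
  | symbol a => .peek .right (fun _ o => o) (.branch (fun v => v == some a)
      (.load (fun _ => none) (.goto fun _ => yes)) (.load (fun _ => none) (.goto fun _ => no)))
  | moreRight => .peek .right (fun _ o => o) (.branch Option.isSome
      (.load (fun _ => none) (.goto fun _ => yes)) (.load (fun _ => none) (.goto fun _ => no)))
  | moreLeft => .peek .left (fun _ o => o) (.branch Option.isSome
      (.load (fun _ => none) (.goto fun _ => yes)) (.load (fun _ => none) (.goto fun _ => no)))

theorem stepAux_code {r : ℕ} {Λ : Type} (yes no : Λ) (p : Test) (hp : p.Fits r) (s : Mem) :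
    TM2.stepAux (p.code r yes no) none s.stk =
      ⟨some (if p.eval s then yes else no), none, s.stk⟩ := by
  cases p with
  | nonzero i =>
    have hi : i < r := hp
    simp only [code, hi, dif_pos, TM2.stepAux, eval, Mem.stk]
    by_cases h : s.cnt i = 0
    · simp [h]
    · obtain ⟨n, hn⟩ := Nat.exists_eq_succ_of_ne_zero h
      simp [hn, List.replicate_succ]
  | symbol a =>
    simp only [code, TM2.stepAux, eval, Mem.stk]
    by_cases h : (s.right.head? == some a) = true <;> simp [h]
  | moreRight =>
    simp only [code, TM2.stepAux, eval, Mem.stk]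
    obtain ⟨l, _ | ⟨a, w⟩, c⟩ := s <;> simp
  | moreLeft =>
    simp only [code, TM2.stepAux, eval, Mem.stk]
    obtain ⟨_ | ⟨a, w⟩, l, c⟩ := s <;> simp

end Test

/-- A program: a control flow graph with one entry and one exit, whose code can be placed into
any larger machine. -/
structure Prog (r : ℕ) where
  /-- The labels. -/
  Lab : Type
  [fin : Fintype Lab]
  /-- The entry label. -/
  entry : Lab
  /-- The code, given an embedding of the labels into those of a machine and an exit label. -/
  code : ∀ {Λ : Type}, (Lab → Λ) → Λ → Lab → Code r Λ

/-- `m` leads from `a` to `b` in `t` steps. -/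
def Steps {r : ℕ} {Λ : Type} (m : Λ → Code r Λ) (t : ℕ) (a b : Config r Λ) : Prop :=
  (flip bind (TM2.step m))^[t] (some a) = some b

theorem Steps.trans {r : ℕ} {Λ : Type} {m : Λ → Code r Λ} {t u : ℕ} {a b c : Config r Λ}
    (h : Steps m t a b) (h' : Steps m u b c) : Steps m (t + u) a c := by
  unfold Steps at *
  rw [add_comm, iterate_add_apply, h, h']

theorem Steps.single {r : ℕ} {Λ : Type} {m : Λ → Code r Λ} {l : Λ} {v : Control}
    {S : ∀ k : Reg r, List k.Alphabet} {b : Config r Λ} (h : TM2.stepAux (m l) v S = b) :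
    Steps m 1 ⟨some l, v, S⟩ b := by
  simp [Steps, flip, h]

/-! ### Control flow graphs: sequence, conditional, loop -/

namespace Prog

variable {r : ℕ}

instance (F : Prog r) : Fintype F.Lab := F.fin

/-- `F` transforms the memory `s` into `s'` in at most `T` steps. -/
def Runs (F : Prog r) (s s' : Mem) (T : ℕ) : Prop :=
  ∃ t ≤ T, ∀ (Λ : Type) (m : Λ → Code r Λ) (emb : F.Lab → Λ) (exit : Λ),
    (∀ l, m (emb l) = F.code emb exit l) →
      Steps m t ⟨some (emb F.entry), none, s.stk⟩ ⟨some exit, none, s'.stk⟩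

theorem Runs.mono {F : Prog r} {s s' : Mem} {T U : ℕ} (h : F.Runs s s' T) (hTU : T ≤ U) :
    F.Runs s s' U :=
  let ⟨t, ht, h⟩ := h
  ⟨t, ht.trans hTU, h⟩

/-- A single instruction. -/
def instr (r : ℕ) (p : Instr) : Prog r where
  Lab := Unit
  entry := ()
  code _ exit _ := p.code r exit

theorem runs_instr (p : Instr) (hp : p.Fits r) (s : Mem) :
    (instr r p).Runs s (p.eval s) 1 :=
  ⟨1, le_rfl, fun Λ m emb exit h => Steps.single <| by
    rw [h]; exact Instr.stepAux_code exit p hp s⟩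

/-- Sequential composition. -/
def seq (F G : Prog r) : Prog r where
  Lab := F.Lab ⊕ G.Lab
  entry := .inl F.entry
  code emb exit l := match l with
    | .inl l => F.code (emb ∘ .inl) (emb (.inr G.entry)) l
    | .inr l => G.code (emb ∘ .inr) exit l

/-- `Runs` quantifies over all host machines and exit labels, so the run of `F` may be instantiated
with the entry of `G` as its exit. -/
theorem Runs.seq {F G : Prog r} {s s' s'' : Mem} {T U : ℕ} (h : F.Runs s s' T)
    (h' : G.Runs s' s'' U) : (F.seq G).Runs s s'' (T + U) := by
  obtain ⟨t, ht, h⟩ := h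
  obtain ⟨u, hu, h'⟩ := h'
  refine ⟨t + u, add_le_add ht hu, fun Λ m emb exit hm => ?_⟩
  exact (h Λ m (emb ∘ .inl) (emb (.inr G.entry)) fun l => hm (.inl l)).trans
    (h' Λ m (emb ∘ .inr) exit fun l => hm (.inr l))

/-- One-armed conditional. -/
def when (p : Test) (F : Prog r) : Prog r where
  Lab := Option F.Lab
  entry := none
  code emb exit l := match l with
    | none => p.code r (emb (some F.entry)) exit
    | some l => F.code (emb ∘ some) exit l

theorem Runs.when {p : Test} (hp : p.Fits r) {F : Prog r} {s s' : Mem} {T : ℕ}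
    (h : p.eval s = true → F.Runs s s' T) (h' : p.eval s = false → s = s') :
    (F.when p).Runs s s' (1 + T) := by
  cases hs : p.eval s with
  | true =>
    obtain ⟨t, ht, h⟩ := h hs
    refine ⟨1 + t, by omega, fun Λ m emb exit hm => ?_⟩
    refine Steps.trans (Steps.single (b := ⟨some (emb (some F.entry)), none, s.stk⟩) ?_)
      (h Λ m (emb ∘ some) exit fun l => hm (some l))
    exact (congrArg (fun q => TM2.stepAux q none s.stk) (hm none)).trans
      ((Test.stepAux_code _ _ p hp s).trans (by simp [hs]))
  | false =>
    refine ⟨1, by omega, fun Λ m emb exit hm => Steps.single ?_⟩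
    rw [← h' hs]
    exact (congrArg (fun q => TM2.stepAux q none s.stk) (hm none)).trans
      ((Test.stepAux_code _ _ p hp s).trans (by simp [hs]))

/-- Iteration as long as a test succeeds. -/
def loop (p : Test) (F : Prog r) : Prog r where
  Lab := Option F.Lab
  entry := none
  code emb exit l := match l with
    | none => p.code r (emb (some F.entry)) exit
    | some l => F.code (emb ∘ some) (emb none) l

theorem runs_loop_stop {p : Test} (hp : p.Fits r) (F : Prog r) {s : Mem}
    (h : p.eval s = false) : (F.loop p).Runs s s 1 := by
  refine ⟨1, le_rfl, fun Λ m emb exit hm => Steps.single ?_⟩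
  exact (congrArg (fun q => TM2.stepAux q none s.stk) (hm none)).trans
    ((Test.stepAux_code _ _ p hp s).trans (by simp [h]))

/-- The body exits to the test label `none`, so the rest of the run is a run of the same loop. -/
theorem Runs.loop_step {p : Test} (hp : p.Fits r) {F : Prog r} {s s' s'' : Mem} {T U : ℕ}
    (hs : p.eval s = true) (h : F.Runs s s' T) (h' : (F.loop p).Runs s' s'' U) :
    (F.loop p).Runs s s'' (1 + T + U) := by
  obtain ⟨t, ht, h⟩ := h
  obtain ⟨u, hu, h'⟩ := h'
  refine ⟨1 + t + u, by omega, fun Λ m emb exit hm => ?_⟩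
  refine Steps.trans (Steps.trans
    (Steps.single (b := ⟨some (emb (some F.entry)), none, s.stk⟩) ?_)
    (h Λ m (emb ∘ some) (emb none) fun l => hm (some l))) (h' Λ m emb exit hm)
  exact (congrArg (fun q => TM2.stepAux q none s.stk) (hm none)).trans
    ((Test.stepAux_code _ _ p hp s).trans (by simp [hs]))

/-- A loop whose body leads from `f (k + 1)` to `f k` and which stops exactly at `f 0`. -/
theorem Runs.loop {p : Test} (hp : p.Fits r) {F : Prog r} (f : ℕ → Mem) (n T : ℕ)
    (h0 : p.eval (f 0) = false) (h1 : ∀ k < n, p.eval (f (k + 1)) = true)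
    (h : ∀ k < n, F.Runs (f (k + 1)) (f k) T) :
    (F.loop p).Runs (f n) (f 0) (n * (1 + T) + 1) := by
  induction n with
  | zero => simpa using runs_loop_stop hp F h0
  | succ n ih =>
    refine ((Runs.loop_step hp (h1 n n.lt_succ_self) (h n n.lt_succ_self)
      (ih (fun k hk => h1 k (by omega)) fun k hk => h k (by omega)))).mono ?_
    rw [Nat.succ_mul]; omega

end Prog

/-! ### From programs to Turing machines -/

namespace Prog

variable {r : ℕ}

/-- Erase the input to the right of the head. -/
def erase (r : ℕ) : Prog r := loop .moreRight (instr r .drop)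

theorem runs_erase (w : List (Option Bool)) (c : ℕ → ℕ) :
    (erase r).Runs ⟨[], w, c⟩ ⟨[], [], c⟩ (w.length * 2 + 1) := by
  induction w with
  | nil => exact (runs_loop_stop (p := .moreRight) trivial _ rfl).mono (by simp)
  | cons a w ih =>
    refine (Runs.loop_step (p := .moreRight) trivial rfl
      (runs_instr .drop trivial ⟨[], a :: w, c⟩) ih).mono ?_
    simp; omega

/-- The machine that runs a program, erases its input, and outputs whether counter `0` is
positive. -/
def deciderCode (F : Prog r) (h : 0 < r) :
    (F.seq (erase r)).Lab ⊕ Option Bool → Code r ((F.seq (erase r)).Lab ⊕ Option Bool)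
  | .inl l => (F.seq (erase r)).code .inl (.inr none) l
  | .inr none => Test.code r (.inr (some true)) (.inr (some false)) (.nonzero 0)
  | .inr (some b) => .push .out (fun _ => b) (.pop (.cnt ⟨0, h⟩) (fun v _ => v) .halt)

/-- `deciderCode` as a bundled machine. -/
def decider (F : Prog r) (h : 0 < r) : FinTM2 where
  K := Reg r
  k₀ := .right
  k₁ := .out
  Γ := Reg.Alphabet
  Λ := (F.seq (erase r)).Lab ⊕ Option Bool
  main := .inl (F.seq (erase r)).entry
  σ := Control
  initialState := none
  Γk₀Fin := inferInstanceAs (Fintype (Option Bool))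
  m := deciderCode F h

/-- The stacks at the end of a computation with output `b`. -/
def outStk (b : Bool) : ∀ k : Reg r, List k.Alphabet
  | .out => [b]
  | .right => []
  | .left => []
  | .cnt _ => []

/-- A halting configuration must have every stack empty except the output. Hence the input is
erased, and the last statement pops counter `0` as well as pushing the answer. The two extra steps
are the test of counter `0` and that last statement. -/
theorem steps_deciderCode (F : Prog r) (h : 0 < r) {w : List (Option Bool)} {b : Bool} {T : ℕ}
    (hF : F.Runs ⟨[], w, 0⟩ ⟨[], w, update 0 0 b.toNat⟩ T) :
    ∃ t ≤ T + (w.length * 2 + 1) + 2, Steps (deciderCode F h) t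
      ⟨some (.inl (F.seq (erase r)).entry), none, Mem.stk ⟨[], w, 0⟩⟩
      ⟨none, none, outStk b⟩ := by
  obtain ⟨t, ht, hF⟩ := hF.seq (runs_erase w _)
  refine ⟨t + 2, by omega, (hF _ (deciderCode F h) .inl (.inr none) fun l => rfl).trans ?_⟩
  refine Steps.trans (t := 1) (u := 1)
    (Steps.single (b := ⟨some (.inr (some b)), none, Mem.stk ⟨[], [], update 0 0 b.toNat⟩⟩) ?_)
    (Steps.single ?_)
  · refine (Test.stepAux_code _ _ (.nonzero 0) h _).trans ?_
    cases b <;> simp [Test.eval]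
  · simp only [deciderCode, TM2.stepAux]
    congr 1
    funext k
    rcases k with _ | _ | _ | k
    · simp [Mem.stk, outStk]
    · simp [Mem.stk, outStk]
    · simp [Mem.stk, outStk]
    · by_cases hk : k = ⟨0, h⟩
      · subst hk; cases b <;> simp [Mem.stk, outStk]
      · have : (k : ℕ) ≠ 0 := fun h => hk (Fin.ext h)
        simp [hk, Mem.stk, outStk, this]

/-- A predicate decided by a program in polynomial time is decided by a Turing machine in
polynomial time. -/
theorem computableInPolyTime {α : Type} (F : Prog r) (h : 0 < r) (enc : α → List (Option Bool))
    (g : α → Bool) (q : Polynomial ℕ)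
    (hF : ∀ a, F.Runs ⟨[], enc a, 0⟩ ⟨[], enc a, update 0 0 (g a).toNat⟩
      (q.eval (enc a).length)) :
    Nonempty (TM2ComputableInPolyTime enc Computability.encodeBool g) := by
  refine ⟨⟨⟨decider F h, Equiv.refl _, Equiv.refl _⟩, q + (Polynomial.X * 2 + 1) + 2,
    fun a => ?_⟩⟩
  have H := steps_deciderCode F h (hF a)
  refine ⟨⟨H.choose, ?_⟩, H.choose_spec.1.trans (by simp)⟩
  have h0 : initList (decider F h) ((enc a).map (Equiv.refl _).invFun) =
      ⟨some (.inl (F.seq (erase r)).entry), none, Mem.stk ⟨[], enc a, 0⟩⟩ := by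
    simp only [initList, decider]
    congr 1
    funext k
    rcases k with _ | _ | _ | k
    · exact List.map_id _
    all_goals rfl
  have h1 : haltList (decider F h) ((Computability.encodeBool (g a)).map (Equiv.refl _).invFun) =
      ⟨none, none, outStk (g a)⟩ := by
    simp only [haltList, decider]
    congr 1
    funext k
    rcases k with _ | _ | _ | k <;> rfl
  exact (congrArg (fun x => (flip bind (decider F h).step)^[H.choose] (some x)) h0).trans
    ((show _ = some _ from H.choose_spec.2).trans (congrArg some h1.symm))

end Prog

end CounterMachine

/-! ### Functions computed in polynomial time with unary counters -/

namespace CounterMachine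

open Turing Function

theorem eval_mono (q : Polynomial ℕ) {a b : ℕ} (h : a ≤ b) : q.eval a ≤ q.eval b := by
  simp only [Polynomial.eval_eq_sum, Polynomial.sum]
  gcongr

/-! ### Counter arithmetic and head movement -/

namespace Prog

variable {r : ℕ} {L R : List (Option Bool)} {c : ℕ → ℕ}

/-- Set counter `i` to zero. -/
abbrev clear (r i : ℕ) : Prog r := loop (.nonzero i) (instr r (.dec i))

theorem runs_clear {i : ℕ} (hi : i < r) :
    (clear r i).Runs ⟨L, R, c⟩ ⟨L, R, update c i 0⟩ (c i * 2 + 1) := by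
  have h := Runs.loop (p := .nonzero i) hi (F := instr r (.dec i))
    (fun k => ⟨L, R, update c i k⟩) (c i) 1 (by simp [Test.eval]) (by simp [Test.eval])
    fun k _ => by simpa [Instr.eval] using runs_instr (.dec i) hi ⟨L, R, update c i (k + 1)⟩
  simpa using h

/-- Add counter `i` to counter `j` and set it to zero. -/
abbrev move (r i j : ℕ) : Prog r :=
  loop (.nonzero i) ((instr r (.dec i)).seq (instr r (.inc j)))

theorem runs_move {i j : ℕ} (hi : i < r) (hj : j < r) (hij : i ≠ j) :
    (move r i j).Runs ⟨L, R, c⟩ ⟨L, R, update (update c i 0) j (c j + c i)⟩ (c i * 3 + 1) := by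
  have h := Runs.loop (p := .nonzero i) hi (F := (instr r (.dec i)).seq (instr r (.inc j)))
    -- The states are indexed by what is left in counter `i`; counter `j` has received the
    -- difference.
    (fun k => ⟨L, R, update (update c i k) j (c j + (c i - k))⟩) (c i) (1 + 1)
    (by simp [Test.eval, hij]) (by simp [Test.eval, hij])
    fun k hk => by
      refine (runs_instr (.dec i) hi _).seq ?_
      convert runs_instr (.inc j) hj _ using 1
      simp only [Instr.eval, Mem.mk.injEq, true_and]
      funext x
      grind [update_apply]
  convert h using 2
  · funext x; grind [update_apply]
  · rw [Nat.sub_zero]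

/-- Add counter `i` to the counters `j` and `k` and set it to zero. -/
abbrev move₂ (r i j k : ℕ) : Prog r :=
  loop (.nonzero i) ((instr r (.dec i)).seq ((instr r (.inc j)).seq (instr r (.inc k))))

theorem runs_move₂ {i j k : ℕ} (hi : i < r) (hj : j < r) (hk : k < r) (hij : i ≠ j)
    (hik : i ≠ k) (hjk : j ≠ k) :
    (move₂ r i j k).Runs ⟨L, R, c⟩
      ⟨L, R, update (update (update c i 0) j (c j + c i)) k (c k + c i)⟩ (c i * 4 + 1) := by
  have h := Runs.loop (p := .nonzero i) hi
    (F := (instr r (.dec i)).seq ((instr r (.inc j)).seq (instr r (.inc k))))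
    (fun x => ⟨L, R, update (update (update c i x) j (c j + (c i - x))) k (c k + (c i - x))⟩)
    (c i) (1 + (1 + 1)) (by simp [Test.eval, hij, hik]) (by simp [Test.eval, hij, hik])
    fun x hx => by
      refine (runs_instr (.dec i) hi _).seq ((runs_instr (.inc j) hj _).seq ?_)
      convert runs_instr (.inc k) hk _ using 1
      simp only [Instr.eval, Mem.mk.injEq, true_and]
      funext x
      grind [update_apply]
  convert h using 2
  · funext x; grind [update_apply]
  · rw [Nat.sub_zero]

/-- Subtract counter `i` from counter `j` and set it to zero. -/
abbrev subtract (r i j : ℕ) : Prog r :=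
  loop (.nonzero i) ((instr r (.dec i)).seq (instr r (.dec j)))

theorem runs_subtract {i j : ℕ} (hi : i < r) (hj : j < r) (hij : i ≠ j) :
    (subtract r i j).Runs ⟨L, R, c⟩ ⟨L, R, update (update c i 0) j (c j - c i)⟩
      (c i * 3 + 1) := by
  have h := Runs.loop (p := .nonzero i) hi (F := (instr r (.dec i)).seq (instr r (.dec j)))
    (fun k => ⟨L, R, update (update c i k) j (c j - (c i - k))⟩) (c i) (1 + 1)
    (by simp [Test.eval, hij]) (by simp [Test.eval, hij])
    fun k hk => by
      refine (runs_instr (.dec i) hi _).seq ?_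
      convert runs_instr (.dec j) hj _ using 1
      simp only [Instr.eval, Mem.mk.injEq, true_and]
      funext x
      grind [update_apply]
  convert h using 2
  · funext x; grind [update_apply]
  · rw [Nat.sub_zero]

/-- Move the head to the start of the input. -/
abbrev rewind (r : ℕ) : Prog r := loop .moreLeft (instr r .moveLeft)

theorem runs_rewind :
    (rewind r).Runs ⟨L, R, c⟩ ⟨[], L.reverse ++ R, c⟩ (L.length * 2 + 1) := by
  induction L generalizing R with
  | nil => exact (runs_loop_stop (p := .moreLeft) trivial _ rfl).mono (by simp)
  | cons a w ih =>
    refine (Runs.loop_step (p := .moreLeft) trivial rfl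
      (runs_instr .moveLeft trivial ⟨a :: w, R, c⟩)
      (by simpa [Instr.eval] using ih (R := a :: R))).mono ?_
    simp; omega

/-- Move the head to the end of the input, counting its cells in counter `i`. -/
abbrev count (r i : ℕ) : Prog r := loop .moreRight ((instr r .moveRight).seq (instr r (.inc i)))

theorem runs_count {i : ℕ} (hi : i < r) :
    (count r i).Runs ⟨L, R, c⟩ ⟨R.reverse ++ L, [], update c i (c i + R.length)⟩
      (R.length * 3 + 1) := by
  induction R generalizing L c with
  | nil => simpa using runs_loop_stop (p := .moreRight) trivial _ rfl
  | cons a w ih =>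
    refine (Runs.loop_step (p := .moreRight) trivial rfl
      ((runs_instr .moveRight trivial ⟨L, a :: w, c⟩).seq (runs_instr (.inc i) hi _))
      (by simpa [Instr.eval, add_assoc, add_comm 1] using
        ih (L := a :: L) (c := update c i (c i + 1)))).mono ?_
    simp; omega

/-- Move the head to the right, as many times as counter `i` says. -/
abbrev seek (r i : ℕ) : Prog r := loop (.nonzero i) ((instr r (.dec i)).seq (instr r .moveRight))

/-- Past the end of the input the head stays put while the counter keeps falling, which agrees with
`take` and `drop`. -/
theorem runs_seek {i : ℕ} (hi : i < r) (n : ℕ) (hn : c i = n) :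
    (seek r i).Runs ⟨L, R, c⟩ ⟨(R.take n).reverse ++ L, R.drop n, update c i 0⟩ (n * 3 + 1) := by
  induction n generalizing L R c with
  | zero =>
    have h := runs_loop_stop (p := .nonzero i) hi ((instr r (.dec i)).seq (instr r .moveRight))
      (s := ⟨L, R, c⟩) (by simp [Test.eval, hn])
    have hc : update c i 0 = c := by rw [← hn, update_eq_self]
    simpa [hc] using h
  | succ n ih =>
    have h := ih (c := update c i n) (L := (Instr.eval .moveRight ⟨L, R, c⟩).left)
      (R := (Instr.eval .moveRight ⟨L, R, c⟩).right) (by simp)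
    refine (Runs.loop_step (p := .nonzero i) hi (by simp [Test.eval, hn])
      ((runs_instr (.dec i) hi ⟨L, R, c⟩).seq (runs_instr .moveRight trivial _))
      (s'' := ⟨(R.take (n + 1)).reverse ++ L, R.drop (n + 1), update c i 0⟩)
      (U := n * 3 + 1) ?_).mono (by omega)
    cases R <;> simpa [Instr.eval, hn] using h

end Prog

/-- The data that a computation reads: an input string and the values of some variables. -/
class Env (E : Type) where
  /-- The input string. -/
  input : E → List (Option Bool)
  /-- The values of the variables. -/
  vars : E → List ℕ

instance : Env (List Bool × List Bool) := ⟨encodePair, fun _ => []⟩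

instance {E : Type} [Env E] : Env (E × ℕ) :=
  ⟨fun e => Env.input e.1, fun e => e.2 :: Env.vars e.1⟩

/-- The size of an environment, with numbers measured in unary. -/
def Env.size {E : Type} [Env E] (e : E) : ℕ := (input e).length + (vars e).sum

/-- The program `F` stores `f e` in counter `d`, where the variables of `e` are found in the
counters `loc` and the counters from `d` onwards are free for use. -/
def Prog.Computes {E : Type} [Env E] {r : ℕ} (F : Prog r) (d : ℕ) (loc : List ℕ) (f : E → ℕ)
    (q : Polynomial ℕ) : Prop :=
  ∀ (e : E) (c : ℕ → ℕ), loc.map c = Env.vars e → (∀ j, d ≤ j → c j = 0) →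
    F.Runs ⟨[], Env.input e, c⟩ ⟨[], Env.input e, update c d (f e)⟩ (q.eval (Env.size e))

/-- `f` is computed in polynomial time, with numbers measured in unary. -/
def Comp {E : Type} [Env E] (f : E → ℕ) : Prop :=
  ∃ q : Polynomial ℕ, (∀ e, f e ≤ q.eval (Env.size e)) ∧
    ∃ n, ∀ r d loc, (∀ l ∈ loc, l < d) → d + n ≤ r → ∃ F : Prog r, F.Computes d loc f q

/-! ### Closure properties of polynomial-time functions -/

namespace Comp

open Prog

variable {E : Type} [Env E]

theorem congr {f g : E → ℕ} (hf : Comp f) (h : ∀ e, g e = f e) : Comp g :=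
  (funext h : g = f) ▸ hf

theorem weaken {f : E → ℕ} (hf : Comp f) : Comp fun e : E × ℕ => f e.1 := by
  obtain ⟨q, hq, n, h⟩ := hf
  have hs (e : E × ℕ) : Env.size e.1 ≤ Env.size e := by
    simp only [Env.size, Env.vars, Env.input, List.sum_cons]; omega
  refine ⟨q, fun e => (hq e.1).trans (eval_mono q (hs e)), n, fun r d loc hl hr => ?_⟩
  obtain ⟨F, hF⟩ := h r d loc.tail (fun l h => hl l (List.mem_of_mem_tail h)) hr
  refine ⟨F, fun e c hc hd => (hF e.1 c ?_ hd).mono (eval_mono q (hs e))⟩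
  rw [List.map_tail, hc]
  rfl

theorem var : Comp fun e : E × ℕ => e.2 := by
  have hs (e : E × ℕ) : e.2 ≤ Env.size e := by
    simp only [Env.size, Env.vars, List.sum_cons]; omega
  refine ⟨Polynomial.X * 7 + 2, fun e => ?_, 2, fun r d loc hl hr => ?_⟩
  · simpa using (hs e).trans (by omega)
  cases loc with
  -- Vacuous: the environment has at least one variable, so its list of locations is nonempty.
  | nil => exact ⟨clear r d, fun e c hc => by simp [Env.vars] at hc⟩
  | cons l loc =>
    have hld := hl l (by simp)
    -- Copying destroys the source, so a second copy is made in `d + 1` and moved back to `l`.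
    refine ⟨(move₂ r l d (d + 1)).seq (move r (d + 1) l), fun e c hc hd => ?_⟩
    have hce : c l = e.2 := (List.cons.inj hc).1
    have h0 := hd d le_rfl
    have h1 := hd (d + 1) (by omega)
    have H := (runs_move₂ (L := []) (R := Env.input e) (c := c) (show l < r by omega)
      (show d < r by omega) (show d + 1 < r by omega) (by omega) (by omega) (by omega)).seq
      (runs_move (show d + 1 < r by omega) (show l < r by omega) (by omega))
    refine Runs.mono ?_ (T := e.2 * 4 + 1 + (e.2 * 3 + 1))
      (by simp only [Polynomial.eval_add, Polynomial.eval_mul, Polynomial.eval_X,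
        Polynomial.eval_ofNat]; have := hs e; omega)
    convert H using 2
    · funext x; grind [update_apply]
    · rw [hce]
    · simp [h1, hce]

theorem zero : Comp fun _ : E => 0 := by
  refine ⟨1, fun e => by simp, 1, fun r d loc hl hr => ⟨clear r d, fun e c hc hd => ?_⟩⟩
  simpa [hd] using runs_clear (L := []) (R := Env.input e) (c := c) (show d < r by omega)

theorem succ {f : E → ℕ} (hf : Comp f) : Comp fun e => f e + 1 := by
  obtain ⟨q, hq, n, h⟩ := hf
  refine ⟨q + 1, fun e => by simpa using hq e, n + 1, fun r d loc hl hr => ?_⟩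
  obtain ⟨F, hF⟩ := h r d loc hl (by omega)
  refine ⟨F.seq (instr r (.inc d)), fun e c hc hd => ?_⟩
  simpa [Instr.eval] using (hF e c hc hd).seq (runs_instr (.inc d) (show d < r by omega) _)

theorem const (k : ℕ) : Comp fun _ : E => k := by
  induction k with
  | zero => exact zero
  | succ k ih => exact ih.succ

theorem add {f g : E → ℕ} (hf : Comp f) (hg : Comp g) : Comp fun e => f e + g e := by
  obtain ⟨q, hq, n, h⟩ := hf
  obtain ⟨q', hq', n', h'⟩ := hg
  refine ⟨q + q' + (q' * 3 + 1), fun e => ?_, n + n' + 2, fun r d loc hl hr => ?_⟩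
  · have := hq e
    have := hq' e
    simp; omega
  obtain ⟨F, hF⟩ := h r d loc hl (by omega)
  obtain ⟨G, hG⟩ := h' r (d + 1) loc (fun l h => (hl l h).trans (by omega)) (by omega)
  refine ⟨(F.seq G).seq (move r (d + 1) d), fun e c hc hd => ?_⟩
  have H := ((hF e c hc hd).seq (hG e (update c d (f e)) ?_ ?_)).seq
    (runs_move (show d + 1 < r by omega) (show d < r by omega) (by omega))
  · refine Runs.mono ?_ (T := q.eval (Env.size e) + q'.eval (Env.size e) + (g e * 3 + 1)) ?_
    · convert H using 2
      · funext x; grind [update_apply]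
      · simp
    · have := hq' e
      simp; omega
  · rw [← hc]
    exact List.map_congr_left fun l h => update_of_ne (hl l h).ne _ _
  · intro j hj
    rw [update_of_ne (by omega), hd j (by omega)]

theorem sub {f g : E → ℕ} (hf : Comp f) (hg : Comp g) : Comp fun e => f e - g e := by
  obtain ⟨q, hq, n, h⟩ := hf
  obtain ⟨q', hq', n', h'⟩ := hg
  refine ⟨q + q' + (q' * 3 + 1), fun e => ?_, n + n' + 2, fun r d loc hl hr => ?_⟩
  · have := hq e
    simp; omega
  obtain ⟨F, hF⟩ := h r d loc hl (by omega)
  obtain ⟨G, hG⟩ := h' r (d + 1) loc (fun l h => (hl l h).trans (by omega)) (by omega)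
  refine ⟨(F.seq G).seq (subtract r (d + 1) d), fun e c hc hd => ?_⟩
  have H := ((hF e c hc hd).seq (hG e (update c d (f e)) ?_ ?_)).seq
    (runs_subtract (show d + 1 < r by omega) (show d < r by omega) (by omega))
  · refine Runs.mono ?_ (T := q.eval (Env.size e) + q'.eval (Env.size e) + (g e * 3 + 1)) ?_
    · convert H using 2
      · funext x; grind [update_apply]
      · simp
    · have := hq' e
      simp; omega
  · rw [← hc]
    exact List.map_congr_left fun l h => update_of_ne (hl l h).ne _ _
  · intro j hj
    rw [update_of_ne (by omega), hd j (by omega)]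

theorem length : Comp fun e : E => (Env.input e).length := by
  refine ⟨Polynomial.X * 5 + 2, fun e => ?_, 1, fun r d loc hl hr =>
    ⟨(count r d).seq (rewind r), fun e c hc hd => ?_⟩⟩
  · simp [Env.size]; omega
  · have H := (runs_count (L := []) (R := Env.input e) (c := c) (show d < r by omega)).seq
      runs_rewind
    refine Runs.mono (by simpa [hd] using H) ?_
    simp [Env.size]; omega

theorem symbol (a : Option Bool) {f : E → ℕ} (hf : Comp f) :
    Comp fun e => if (Env.input e)[f e]? = some a then 1 else 0 := by
  obtain ⟨q, hq, n, h⟩ := hf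
  refine ⟨q + (q * 3 + 1) + 2 + (Polynomial.X * 2 + 1), fun e => ?_, n + 1,
    fun r d loc hl hr => ?_⟩
  · dsimp only
    split_ifs <;> simp
    omega
  obtain ⟨F, hF⟩ := h r d loc hl (by omega)
  refine ⟨((F.seq (seek r d)).seq (when (.symbol a) (instr r (.inc d)))).seq (rewind r),
    fun e c hc hd => ?_⟩
  have H := (((hF e c hc hd).seq (runs_seek (show d < r by omega) (f e) (by simp))).seq
    -- Seeking has reset counter `d` to zero, so it can now receive the 0/1 answer.
    (Runs.when (p := .symbol a) (F := instr r (.inc d)) trivial (T := 1)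
      (s' := ⟨((Env.input e).take (f e)).reverse, (Env.input e).drop (f e),
        update c d (if (Env.input e)[f e]? = some a then 1 else 0)⟩) ?_ ?_)).seq runs_rewind
  · refine Runs.mono (by simpa using H) ?_
    have : min (f e) (Env.input e).length ≤ Env.size e :=
      (min_le_right _ _).trans (Nat.le_add_right _ _)
    have := hq e
    simp only [Polynomial.eval_add, Polynomial.eval_mul, Polynomial.eval_X,
      Polynomial.eval_ofNat, Polynomial.eval_one]
    omega
  · intro ht
    simp only [Test.eval, List.head?_drop, beq_iff_eq] at ht
    convert runs_instr (.inc d) (show d < r by omega) _ using 1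
    simp [Instr.eval, ht]
  · intro ht
    simp only [Test.eval, List.head?_drop, beq_eq_false_iff_ne] at ht
    simp [ht]

/-- Counter `d` holds the number of iterations left, `d + 1` the partial sum, `d + 2` the summation
index, which the body reads as its newest variable, and `d + 3` the current term. The index is below
`f e`, hence polynomially bounded, so the cost of a term is bounded by the composite polynomial `Q`.
-/
theorem sum {f : E → ℕ} {g : E → ℕ → ℕ} (hf : Comp f) (hg : Comp fun e : E × ℕ => g e.1 e.2) :
    Comp fun e => ∑ x ∈ Finset.range (f e), g e x := by
  obtain ⟨q, hq, n, h⟩ := hf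
  obtain ⟨q', hq', n', h'⟩ := hg
  set Q : Polynomial ℕ := q'.comp (Polynomial.X + q) with hQ
  have hsize (e : E) (x : ℕ) (hx : x < f e) : q'.eval (Env.size (e, x)) ≤ Q.eval (Env.size e) := by
    rw [hQ, Polynomial.eval_comp]
    refine eval_mono _ ?_
    have := hq e
    simp only [Env.size, Env.vars, Env.input, List.sum_cons, Polynomial.eval_add,
      Polynomial.eval_X] at *
    omega
  have hgQ (e : E) (x : ℕ) (hx : x < f e) : g e x ≤ Q.eval (Env.size e) :=
    (hq' (e, x)).trans (hsize e x hx)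
  have hsum (e : E) : ∑ x ∈ Finset.range (f e), g e x ≤
      q.eval (Env.size e) * Q.eval (Env.size e) := by
    refine (Finset.sum_le_card_nsmul _ _ _ fun x hx => hgQ e x (Finset.mem_range.1 hx)).trans ?_
    simpa using Nat.mul_le_mul_right _ (hq e)
  refine ⟨q + (q * (1 + (1 + Q + (Q * 3 + 1) + 1)) + 1) + (q * 2 + 1) + (q * Q * 3 + 1),
    fun e => (hsum e).trans ?_, n + n' + 4, fun r d loc hl hr => ?_⟩
  · simp; omega
  obtain ⟨F, hF⟩ := h r d loc hl (by omega)
  obtain ⟨G, hG⟩ := h' r (d + 3) ((d + 2) :: loc) (by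
    intro l h
    rcases List.mem_cons.1 h with rfl | h
    · omega
    · exact (hl l h).trans (by omega)) (by omega)
  set body := (((instr r (.dec d)).seq G).seq (move r (d + 3) (d + 1))).seq
    (instr r (.inc (d + 2)))
  refine ⟨((F.seq (loop (.nonzero d) body)).seq (clear r (d + 2))).seq (move r (d + 1) d),
    fun e c hc hd => ?_⟩
  let st : ℕ → Mem := fun k => ⟨[], Env.input e, update (update (update c d k) (d + 1)
    (∑ x ∈ Finset.range (f e - k), g e x)) (d + 2) (f e - k)⟩
  have hstep (k : ℕ) (hk : k < f e) : body.Runs (st (k + 1)) (st k)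
      (1 + Q.eval (Env.size e) + (Q.eval (Env.size e) * 3 + 1) + 1) := by
    obtain ⟨x, hx⟩ : ∃ x, f e = k + 1 + x := ⟨_, (Nat.add_sub_of_le hk).symm⟩
    have hx1 : f e - (k + 1) = x := by omega
    have hx2 : f e - k = x + 1 := by omega
    have H1 := runs_instr (r := r) (.dec d) (show d < r by omega) (st (k + 1))
    have e1 : Instr.eval (.dec d) (st (k + 1)) = ⟨[], Env.input e,
        update (update (update c d k) (d + 1) (∑ x ∈ Finset.range x, g e x)) (d + 2) x⟩ := by
      simp only [st, Instr.eval, Mem.mk.injEq, true_and, hx1]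
      funext y; grind [update_apply]
    have H2 := hG (e, x)
      (update (update (update c d k) (d + 1) (∑ x ∈ Finset.range x, g e x)) (d + 2) x) (by
        refine List.cons_eq_cons.2 ⟨by simp, ?_⟩
        rw [show Env.vars (e, x).1 = loc.map c from hc.symm]
        refine List.map_congr_left fun l h => ?_
        have := hl l h
        grind [update_apply]) (by
        intro j hj
        have := hd j (by omega)
        grind [update_apply])
    have H3 := ((H1.seq (e1 ▸ H2.mono (hsize e x (by omega)))).seq (runs_move
      (show d + 3 < r by omega) (show d + 1 < r by omega) (by omega))).seq
      (runs_instr (.inc (d + 2)) (show d + 2 < r by omega) _)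
    refine Runs.mono ?_ (T := 1 + Q.eval (Env.size e) + (g e x * 3 + 1) + 1)
      (by have := hgQ e x (by omega); omega)
    convert H3 using 1
    · simp only [st, Instr.eval, Mem.mk.injEq, true_and, hx2, Finset.sum_range_succ]
      have := hd (d + 3) (by omega)
      refine ⟨rfl, ?_⟩
      funext y; grind [update_apply]
    · simp
  have h1 := hd (d + 1) (by omega)
  have h2 := hd (d + 2) (by omega)
  have e2 : st (f e) = ⟨[], Env.input e, update c d (f e)⟩ := by
    simp only [st, Mem.mk.injEq, true_and, Nat.sub_self, Finset.range_zero, Finset.sum_empty]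
    funext y; grind [update_apply]
  have hloop := Runs.loop (p := .nonzero d) (show d < r by omega) st (f e) _
    (by simp [st, Test.eval]) (by simp [st, Test.eval]) hstep
  rw [e2] at hloop
  have H := (((hF e c hc hd).seq hloop).seq
    (runs_clear (show d + 2 < r by omega))).seq
    (runs_move (show d + 1 < r by omega) (show d < r by omega) (by omega))
  refine Runs.mono ?_ (T := _) (?_ : q.eval (Env.size e) +
    (f e * (1 + (1 + Q.eval (Env.size e) + (Q.eval (Env.size e) * 3 + 1) + 1)) + 1) +
    (f e * 2 + 1) + ((∑ x ∈ Finset.range (f e), g e x) * 3 + 1) ≤ _)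
  · convert H using 1
    · simp only [Mem.mk.injEq, true_and, Nat.sub_zero]
      funext y; grind [update_apply]
    · simp
  · simp only [Polynomial.eval_add, Polynomial.eval_mul, Polynomial.eval_ofNat,
      Polynomial.eval_one]
    have := hq e
    have := hsum e
    gcongr

end Comp

end CounterMachine

/-! ### Predicates decided in polynomial time -/

namespace CounterMachine

open Turing Function

section

variable {E : Type} [Env E]

theorem Comp.mul {f g : E → ℕ} (hf : Comp f) (hg : Comp g) : Comp fun e => f e * g e :=
  (hf.sum (g := fun e _ => g e) hg.weaken).congr fun e => by simp

open Classical in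
/-- The predicate `P` is decided in polynomial time, with numbers measured in unary. -/
def CompPred (P : E → Prop) : Prop := Comp fun e => if P e then 1 else 0

namespace CompPred

theorem congr {P Q : E → Prop} (hP : CompPred P) (h : ∀ e, Q e ↔ P e) : CompPred Q :=
  (funext fun e => propext (h e) : Q = P) ▸ hP

theorem not {P : E → Prop} (hP : CompPred P) : CompPred fun e => ¬ P e :=
  ((Comp.const 1).sub hP).congr fun e => by by_cases h : P e <;> simp [h]

theorem and {P Q : E → Prop} (hP : CompPred P) (hQ : CompPred Q) :
    CompPred fun e => P e ∧ Q e :=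
  (Comp.mul hP hQ).congr fun e => by by_cases h : P e <;> by_cases h' : Q e <;> simp [h, h']

theorem imp {P Q : E → Prop} (hP : CompPred P) (hQ : CompPred Q) :
    CompPred fun e => P e → Q e :=
  (hP.and hQ.not).not.congr fun e => by tauto

theorem lt {f g : E → ℕ} (hf : Comp f) (hg : Comp g) : CompPred fun e => f e < g e :=
  -- With truncated subtraction, 1 - (1 - (g - f)) is the indicator of f < g.
  ((Comp.const 1).sub ((Comp.const 1).sub (hg.sub hf))).congr fun e => by
    split_ifs <;> omega

theorem le {f g : E → ℕ} (hf : Comp f) (hg : Comp g) : CompPred fun e => f e ≤ g e :=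
  (lt hg hf).not.congr fun e => by simp

theorem eq {f g : E → ℕ} (hf : Comp f) (hg : Comp g) : CompPred fun e => f e = g e :=
  ((le hf hg).and (le hg hf)).congr fun _ => le_antisymm_iff

open Classical in
-- A witness exists iff the sum of the indicators is positive.
theorem bex {f : E → ℕ} {P : E → ℕ → Prop} (hf : Comp f)
    (hP : CompPred fun e : E × ℕ => P e.1 e.2) : CompPred fun e => ∃ x < f e, P e x := by
  refine (lt (Comp.const 0) (hf.sum (g := fun e x => if P e x then 1 else 0) hP)).congr fun e => ?_
  simp [Finset.filter_nonempty_iff]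

theorem ball {f : E → ℕ} {P : E → ℕ → Prop} (hf : Comp f)
    (hP : CompPred fun e : E × ℕ => P e.1 e.2) : CompPred fun e => ∀ x < f e, P e x :=
  (bex (P := fun e x => ¬ P e x) hf hP.not).not.congr fun e => by simp

end CompPred

end

/-! ### Reading the two halves of an encoded pair -/

/-- Environments whose input string encodes a pair. -/
class PairEnv (E : Type) extends Env E where
  /-- The encoded pair. -/
  pair : E → List Bool × List Bool
  input_eq : ∀ e, Env.input e = encodePair (pair e)

instance : PairEnv (List Bool × List Bool) where
  pair := id
  input_eq _ := rfl

instance {E : Type} [PairEnv E] : PairEnv (E × ℕ) where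
  pair e := PairEnv.pair e.1
  input_eq e := PairEnv.input_eq e.1

section

open PairEnv

variable {E : Type} [PairEnv E]

theorem getElem?_encodePair_eq_none (p : List Bool × List Bool) (i : ℕ) :
    (encodePair p)[i]? = some none ↔ i = p.1.length := by
  rw [encodePair, List.getElem?_append]
  split_ifs with h
  · rw [List.length_map] at h
    simp [h.ne]
  · rw [List.length_map] at h ⊢
    rcases hk : i - p.1.length with _ | k
    · simp; omega
    · simp; omega

theorem getElem?_encodePair_fst (p : List Bool × List Bool) (i : ℕ) :
    p.1[i]? = some true ↔ i < p.1.length ∧ (encodePair p)[i]? = some (some true) := by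
  rw [encodePair, List.getElem?_append]
  by_cases h : i < p.1.length
  · simp [h]
  · simp [h]

theorem getElem?_encodePair_snd (p : List Bool × List Bool) (i : ℕ) :
    p.2[i]? = some true ↔ (encodePair p)[p.1.length + 1 + i]? = some (some true) := by
  rw [encodePair, List.getElem?_append_right (by simp; omega), List.length_map,
    show p.1.length + 1 + i - p.1.length = i + 1 by omega]
  simp

/-- The separator occurs only at position `(pair e).1.length`, so summing the positions weighted by
"the symbol here is the separator" returns that length. -/
theorem comp_length_fst : Comp fun e : E => (pair e).1.length := by
  refine (Comp.sum Comp.length (g := fun e x => x * if (Env.input e)[x]? = some none then 1 else 0)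
    (Comp.var.mul (Comp.symbol none Comp.var))).congr fun e => ?_
  simp only [input_eq, getElem?_encodePair_eq_none, mul_ite, mul_one, mul_zero]
  simp [encodePair]

theorem comp_length_snd : Comp fun e : E => (pair e).2.length :=
  ((Comp.length.sub comp_length_fst).sub (Comp.const 1)).congr fun e => by
    simp [input_eq, encodePair]

theorem compPred_symbol (a : Option Bool) {f : E → ℕ} (hf : Comp f) :
    CompPred fun e => (Env.input e)[f e]? = some a :=
  (Comp.symbol a hf).congr fun e => by congr

theorem compPred_fst {f : E → ℕ} (hf : Comp f) :
    CompPred fun e => (pair e).1[f e]? = some true :=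
  ((CompPred.lt hf comp_length_fst).and (compPred_symbol (some true) hf)).congr fun e => by
    rw [getElem?_encodePair_fst, input_eq]

theorem compPred_snd {f : E → ℕ} (hf : Comp f) :
    CompPred fun e => (pair e).2[f e]? = some true :=
  (compPred_symbol (some true) ((comp_length_fst.add (Comp.const 1)).add hf)).congr fun e => by
    rw [getElem?_encodePair_snd, input_eq]

end

open Classical in
/-- A relation on pairs of binary strings that is decided in polynomial time by a counter machine
is decided in polynomial time by a Turing machine. -/
theorem CompPred.polyTimeDecidable {V : List Bool → List Bool → Prop}
    (h : CompPred fun e : List Bool × List Bool => V e.1 e.2) :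
    PolyTimeDecidable fun x y => decide (V x y) := by
  obtain ⟨q, hq, n, h⟩ := h
  -- There are no variables, and the answer goes to counter `0`; `n + 1` counters guarantee that it
  -- exists.
  obtain ⟨F, hF⟩ := h (n + 1) 0 [] (by simp) (by omega)
  refine Prog.computableInPolyTime F (by omega) encodePair _ q fun a => ?_
  have ha : Env.size a = (encodePair a).length := by simp [Env.size, Env.vars, Env.input]
  rw [← ha]
  have hV : (decide (V a.1 a.2)).toNat = if V a.1 a.2 then 1 else 0 := by
    by_cases h : V a.1 a.2 <;> simp [h]
  change F.Runs _ ⟨_, _, update 0 0 (decide (V a.1 a.2)).toNat⟩ _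
  rw [hV]
  exact hF a 0 rfl fun _ _ => rfl

end CounterMachine

/-! ### The verifier -/

/-- The entry `(i, j)` of an `n × n` matrix of zeros and ones, stored in `w` row by row from
position `k` onwards, is one. -/
def Entry (w : List Bool) (k n i j : ℕ) : Prop := w[k + i * n + j]? = some true

/-- `M` is a partial order on `{0, …, n - 1}`. -/
def IsOrder (n : ℕ) (M : ℕ → ℕ → Prop) : Prop :=
  (∀ i < n, M i i) ∧ (∀ i < n, ∀ j < n, M i j → M j i → i = j) ∧
    ∀ i < n, ∀ j < n, ∀ k < n, M i j → M j k → M i k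

/-- `S` is the graph of a function on `{0, …, n - 1}`. -/
def IsGraph (n : ℕ) (S : ℕ → ℕ → Prop) : Prop :=
  ∀ t < n, ∃ i < n, S t i ∧ ∀ j < n, S t j → j = i

/-- For the partial order `M` on `{0, …, n - 1}`, the graph `S` lists the elements along a linear
extension, and the graph `T` chooses an element above every element in the list. -/
def IsExtension (n : ℕ) (M S T : ℕ → ℕ → Prop) : Prop :=
  (∀ t < n, ∀ s < n, ∀ i < n, ∀ j < n, S t i → S s j → M i j → t ≤ s) ∧
    ∀ t < n, ∀ i < n, ∀ k < n, S t i → T t k → M i k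

/-- For some `t`, the element in place `t` of the list `S` is not the first minimal element of the
remaining poset that lies below the element chosen by `T`. -/
def HasDefect (n : ℕ) (M S T : ℕ → ℕ → Prop) : Prop :=
  ∃ t < n, ∃ i < n, ∃ j < n, ∃ k < n, S t i ∧ T t k ∧ j < i ∧ M j k ∧
    (∀ s < n, S s j → t ≤ s) ∧ ∀ s < n, ∀ l < n, S s l → M l j → l ≠ j → s < t

/-- The string `x` consists of `n` in unary, a zero, and an `n × n` matrix. -/
def IsMatrixCode (n : ℕ) (x : List Bool) : Prop :=
  x.length = n + 1 + n * n ∧ (∀ j < n, x[j]? = some true) ∧ ¬ x[n]? = some true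

/-- The string `y` is a certificate for the poset encoded by `x`. -/
def Certifies (x y : List Bool) : Prop :=
  ∃ n < x.length, IsMatrixCode n x ∧ IsOrder n (Entry x (n + 1) n) ∧
    (IsGraph n (Entry y 0 n) ∧ IsGraph n (Entry y (n * n) n) ∧
      ∀ k < y.length, n * n + n * n ≤ k → ¬ y[k]? = some true) ∧
    IsExtension n (Entry x (n + 1) n) (Entry y 0 n) (Entry y (n * n) n) ∧
    HasDefect n (Entry x (n + 1) n) (Entry y 0 n) (Entry y (n * n) n)

/-! ### The verifier runs in polynomial time -/

namespace CounterMachine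

open PairEnv CompPred

variable {E : Type} [PairEnv E]

theorem compPred_entry_fst {k n i j : E → ℕ} (hk : Comp k) (hn : Comp n) (hi : Comp i)
    (hj : Comp j) : CompPred fun e => Entry (pair e).1 (k e) (n e) (i e) (j e) :=
  compPred_fst ((hk.add (hi.mul hn)).add hj)

theorem compPred_entry_snd {k n i j : E → ℕ} (hk : Comp k) (hn : Comp n) (hi : Comp i)
    (hj : Comp j) : CompPred fun e => Entry (pair e).2 (k e) (n e) (i e) (j e) :=
  compPred_snd ((hk.add (hi.mul hn)).add hj)

theorem compPred_isMatrixCode {n : E → ℕ} (hn : Comp n) :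
    CompPred fun e => IsMatrixCode (n e) (pair e).1 :=
  (CompPred.eq comp_length_fst ((hn.add (Comp.const 1)).add (hn.mul hn))).and
    ((ball hn (compPred_fst (E := E × ℕ) Comp.var)).and (compPred_fst hn).not)

/-- Bound variables are handled as de Bruijn indices: `Comp.var` is the innermost one, and each
`weaken` passes one quantifier outwards. -/
theorem compPred_isOrder {n : E → ℕ} (hn : Comp n) :
    CompPred fun e => IsOrder (n e) (Entry (pair e).1 (n e + 1) (n e)) := by
  have hM {i j : ((E × ℕ) × ℕ) × ℕ → ℕ} (hi : Comp i) (hj : Comp j) : CompPred fun e =>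
      Entry (pair e).1 (n e.1.1.1 + 1) (n e.1.1.1) (i e) (j e) :=
    compPred_entry_fst (hn.weaken.weaken.weaken.add (Comp.const 1)) hn.weaken.weaken.weaken hi hj
  have hM₂ {i j : (E × ℕ) × ℕ → ℕ} (hi : Comp i) (hj : Comp j) : CompPred fun e =>
      Entry (pair e).1 (n e.1.1 + 1) (n e.1.1) (i e) (j e) :=
    compPred_entry_fst (hn.weaken.weaken.add (Comp.const 1)) hn.weaken.weaken hi hj
  refine (ball hn (compPred_entry_fst (E := E × ℕ) (hn.weaken.add (Comp.const 1)) hn.weaken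
    Comp.var Comp.var)).and ((ball hn (ball hn.weaken ?_)).and
    (ball hn (ball hn.weaken (ball hn.weaken.weaken ?_))))
  · exact (hM₂ Comp.var.weaken Comp.var).imp ((hM₂ Comp.var Comp.var.weaken).imp
      (CompPred.eq Comp.var.weaken Comp.var))
  · exact (hM Comp.var.weaken.weaken Comp.var.weaken).imp ((hM Comp.var.weaken Comp.var).imp
      (hM Comp.var.weaken.weaken Comp.var))

theorem compPred_isGraph {k n : E → ℕ} (hk : Comp k) (hn : Comp n) :
    CompPred fun e => IsGraph (n e) (Entry (pair e).2 (k e) (n e)) :=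
  ball hn (bex hn.weaken ((compPred_entry_snd (E := (E × ℕ) × ℕ) hk.weaken.weaken
    hn.weaken.weaken Comp.var.weaken Comp.var).and
    (ball hn.weaken.weaken ((compPred_entry_snd (E := ((E × ℕ) × ℕ) × ℕ) hk.weaken.weaken.weaken
      hn.weaken.weaken.weaken Comp.var.weaken.weaken Comp.var).imp
      (CompPred.eq Comp.var Comp.var.weaken)))))

theorem compPred_isExtension {n : E → ℕ} (hn : Comp n) :
    CompPred fun e => IsExtension (n e) (Entry (pair e).1 (n e + 1) (n e))
      (Entry (pair e).2 0 (n e)) (Entry (pair e).2 (n e * n e) (n e)) := by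
  have h1 := hn.weaken
  have h2 := h1.weaken
  have h3 := h2.weaken
  have h4 := h3.weaken
  refine (ball hn (ball h1 (ball h2 (ball h3 ?_)))).and (ball hn (ball h1 (ball h2 ?_)))
  · exact (compPred_entry_snd (E := (((E × ℕ) × ℕ) × ℕ) × ℕ) (Comp.const 0) h4
      Comp.var.weaken.weaken.weaken Comp.var.weaken).imp
      ((compPred_entry_snd (E := (((E × ℕ) × ℕ) × ℕ) × ℕ) (Comp.const 0) h4
        Comp.var.weaken.weaken Comp.var).imp
      ((compPred_entry_fst (E := (((E × ℕ) × ℕ) × ℕ) × ℕ) (h4.add (Comp.const 1)) h4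
        Comp.var.weaken Comp.var).imp
      (CompPred.le Comp.var.weaken.weaken.weaken Comp.var.weaken.weaken)))
  · exact (compPred_entry_snd (E := ((E × ℕ) × ℕ) × ℕ) (Comp.const 0) h3
      Comp.var.weaken.weaken Comp.var.weaken).imp
      ((compPred_entry_snd (E := ((E × ℕ) × ℕ) × ℕ) (h3.mul h3) h3
        Comp.var.weaken.weaken Comp.var).imp
      (compPred_entry_fst (E := ((E × ℕ) × ℕ) × ℕ) (h3.add (Comp.const 1)) h3
        Comp.var.weaken Comp.var))

theorem compPred_hasDefect {n : E → ℕ} (hn : Comp n) :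
    CompPred fun e => HasDefect (n e) (Entry (pair e).1 (n e + 1) (n e))
      (Entry (pair e).2 0 (n e)) (Entry (pair e).2 (n e * n e) (n e)) := by
  have h1 := hn.weaken
  have h2 := h1.weaken
  have h3 := h2.weaken
  have h4 := h3.weaken
  have h5 := h4.weaken
  have h6 := h5.weaken
  have k : Comp fun e : (((E × ℕ) × ℕ) × ℕ) × ℕ => e.2 := Comp.var
  have j : Comp fun e : (((E × ℕ) × ℕ) × ℕ) × ℕ => e.1.2 := Comp.var.weaken
  have i : Comp fun e : (((E × ℕ) × ℕ) × ℕ) × ℕ => e.1.1.2 := Comp.var.weaken.weaken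
  have t : Comp fun e : (((E × ℕ) × ℕ) × ℕ) × ℕ => e.1.1.1.2 := Comp.var.weaken.weaken.weaken
  refine bex hn (bex h1 (bex h2 (bex h3 ?_)))
  exact (compPred_entry_snd (E := (((E × ℕ) × ℕ) × ℕ) × ℕ) (Comp.const 0) h4 t i).and
    ((compPred_entry_snd (E := (((E × ℕ) × ℕ) × ℕ) × ℕ) (h4.mul h4) h4 t k).and
    ((CompPred.lt j i).and
    ((compPred_entry_fst (E := (((E × ℕ) × ℕ) × ℕ) × ℕ) (h4.add (Comp.const 1)) h4 j k).and
    ((ball h4 ((compPred_entry_snd (E := ((((E × ℕ) × ℕ) × ℕ) × ℕ) × ℕ) (Comp.const 0) h5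
      Comp.var j.weaken).imp (CompPred.le t.weaken Comp.var))).and
    (ball h4 (ball h5 ((compPred_entry_snd (E := (((((E × ℕ) × ℕ) × ℕ) × ℕ) × ℕ) × ℕ)
      (Comp.const 0) h6 Comp.var.weaken Comp.var).imp
      ((compPred_entry_fst (E := (((((E × ℕ) × ℕ) × ℕ) × ℕ) × ℕ) × ℕ) (h6.add (Comp.const 1)) h6
        Comp.var j.weaken.weaken).imp
      ((CompPred.eq Comp.var j.weaken.weaken).not.imp
        (CompPred.lt Comp.var.weaken t.weaken.weaken))))))))))

theorem compPred_certifies :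
    CompPred fun e : List Bool × List Bool => Certifies e.1 e.2 := by
  have n : Comp fun e : (List Bool × List Bool) × ℕ => e.2 := Comp.var
  refine bex (comp_length_fst (E := List Bool × List Bool)) ?_
  exact (compPred_isMatrixCode n).and ((compPred_isOrder n).and
    (((compPred_isGraph (Comp.const 0) n).and ((compPred_isGraph (n.mul n) n).and
      (ball comp_length_snd ((CompPred.le ((n.mul n).add (n.mul n)).weaken Comp.var).imp
        (compPred_snd (E := ((List Bool × List Bool) × ℕ) × ℕ) Comp.var).not)))).and
    ((compPred_isExtension n).and (compPred_hasDefect n))))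

end CounterMachine

/-! ### Linear extensions with chosen upper bounds -/

namespace LinExt

variable {X : Type}

/-- The elements of `R` that are not among the first `t` terms of a sequence. -/
def remaining (R : Set X) {k : ℕ} (s : Fin k → X × X) (t : Fin k) : Set X :=
  {z | z ∈ R ∧ ∀ u < t, (s u).1 ≠ z}

theorem remaining_cons_zero (R : Set X) {k : ℕ} (p : X × X) (s : Fin k → X × X) :
    remaining R (Fin.cons p s) 0 = R := by
  simp [remaining]

theorem remaining_cons_succ (R : Set X) {k : ℕ} (p : X × X) (s : Fin k → X × X) (t : Fin k) :
    remaining R (Fin.cons p s) t.succ = remaining (R \ {p.1}) s t := by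
  ext z
  simp [remaining, Fin.forall_fin_succ, and_assoc, eq_comm]

theorem surjective_of_injective [Fintype X] {s : Fin (Fintype.card X) → X × X}
    (h : Function.Injective fun t => (s t).1) (x : X) : ∃ t, (s t).1 = x :=
  ((Fintype.bijective_iff_injective_and_card _).2 ⟨h, by simp⟩).2 x

variable [PartialOrder X]

/-- `m` is the first minimal element of `R` below `y`, with respect to the ranking `ρ`. -/
def IsFirstBelow (ρ : X → ℕ) (R : Set X) (y m : X) : Prop :=
  Minimal (· ∈ R) m ∧ m ≤ y ∧ ∀ j, Minimal (· ∈ R) j → j ≤ y → ρ m ≤ ρ j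

/-- By finiteness, below any element of `R` there is a minimal element of `R`; take one of least
rank. -/
theorem exists_isFirstBelow [Finite X] (ρ : X → ℕ) {R : Set X} {y : X} (hy : y ∈ R) :
    ∃ m, IsFirstBelow ρ R y m := by
  obtain ⟨m, hm, hmy⟩ := (Set.toFinite R).exists_le_minimal hy
  obtain ⟨m, ⟨h1, h2⟩, h3⟩ := Set.exists_min_image {m | Minimal (· ∈ R) m ∧ m ≤ y} ρ
    (Set.toFinite _) ⟨m, hmy, hm⟩
  exact ⟨m, h1, h2, fun j hj hjy => h3 j ⟨hj, hjy⟩⟩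

theorem IsFirstBelow.unique {ρ : X → ℕ} (hρ : ρ.Injective) {R : Set X} {y m m' : X}
    (h : IsFirstBelow ρ R y m) (h' : IsFirstBelow ρ R y m') : m = m' :=
  hρ (le_antisymm (h.2.2 m' h'.1 h'.2.1) (h'.2.2 m h.1 h.2.1))

/-- In each step, an arbitrary element of the remaining set and the first minimal element below
it are chosen, and the latter is removed. -/
def IsGood (ρ : X → ℕ) (R : Set X) {k : ℕ} (s : Fin k → X × X) : Prop :=
  ∀ t, (s t).2 ∈ remaining R s t ∧ IsFirstBelow ρ (remaining R s t) (s t).2 (s t).1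

theorem isGood_cons {ρ : X → ℕ} {R : Set X} {k : ℕ} {p : X × X} {s : Fin k → X × X} :
    IsGood ρ R (Fin.cons p s : Fin (k + 1) → X × X) ↔
      (p.2 ∈ R ∧ IsFirstBelow ρ R p.2 p.1) ∧ IsGood ρ (R \ {p.1}) s := by
  simp [IsGood, Fin.forall_fin_succ, remaining_cons_zero, remaining_cons_succ]

/-- The first choice y ranges over all of `R` and determines the removed element m. Whichever y is
taken, k elements remain, so induction gives (k + 1) · k!. -/
theorem card_isGood [Finite X] {ρ : X → ℕ} (hρ : ρ.Injective) (k : ℕ) (R : Set X)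
    (hR : R.ncard = k) : Nat.card {s : Fin k → X × X // IsGood ρ R s} = k ! := by
  induction k generalizing R with
  | zero =>
    have : Unique {s : Fin 0 → X × X // IsGood ρ R s} :=
      ⟨⟨⟨Fin.elim0, fun t => t.elim0⟩⟩, fun s => Subtype.ext (Subsingleton.elim _ _)⟩
    simp
  | succ k ih =>
    choose m hm using fun y : R => exists_isFirstBelow ρ y.2
    have hc (y : R) : Nat.card {s : Fin k → X × X // IsGood ρ (R \ {m y}) s} = k ! := by
      refine ih _ ?_
      rw [Set.ncard_sdiff_singleton_of_mem (hm y).1.prop, hR, Nat.add_sub_cancel]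
    let F : (Σ y : R, {s : Fin k → X × X // IsGood ρ (R \ {m y}) s}) →
        {s : Fin (k + 1) → X × X // IsGood ρ R s} :=
      fun a => ⟨Fin.cons (m a.1, (a.1 : X)) a.2.1, isGood_cons.2 ⟨⟨a.1.2, hm a.1⟩, a.2.2⟩⟩
    have hF : F.Bijective := by
      constructor
      -- Different y may remove the same m, but y itself is recorded in the second component.
      · rintro ⟨⟨y, hy⟩, s, hs⟩ ⟨⟨y', hy'⟩, s', hs'⟩ h
        obtain ⟨h1, h2⟩ := (Fin.cons_inj (α := fun _ => X × X)).1 (congrArg Subtype.val h)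
        obtain rfl : y = y' := (Prod.mk.inj h1).2
        subst h2
        rfl
      · rintro ⟨s, hs⟩
        rw [← Fin.cons_self_tail s] at hs
        obtain ⟨⟨h1, h2⟩, h3⟩ := isGood_cons.1 hs
        have h4 : (s 0).1 = m ⟨(s 0).2, h1⟩ := h2.unique hρ (hm _)
        rw [h4] at h3
        refine ⟨⟨⟨(s 0).2, h1⟩, Fin.tail s, h3⟩, Subtype.ext ?_⟩
        change Fin.cons (m ⟨(s 0).2, h1⟩, (s 0).2) (Fin.tail s) = s
        rw [← h4]
        exact Fin.cons_self_tail s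
    have := Fintype.ofFinite R
    rw [← Nat.card_congr (Equiv.ofBijective F hF), Nat.card_sigma]
    simp only [hc, Finset.sum_const, Finset.card_univ, smul_eq_mul, Nat.factorial_succ]
    rw [← Nat.card_eq_fintype_card, Nat.card_coe_set_eq, hR]

/-- A sequence lists the elements along a linear extension, together with upper bounds. -/
def IsExt {k : ℕ} (s : Fin k → X × X) : Prop :=
  (∀ t u, (s t).1 ≤ (s u).1 → t ≤ u) ∧ ∀ t, (s t).1 ≤ (s t).2

/-- In some step, the removed element is not the first minimal element below the chosen one. -/
def Defect (ρ : X → ℕ) {k : ℕ} (s : Fin k → X × X) : Prop :=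
  ∃ t j, ρ j < ρ (s t).1 ∧ j ≤ (s t).2 ∧ (∀ u, (s u).1 = j → t ≤ u) ∧ ∀ u, (s u).1 < j → u < t

theorem IsExt.injective {k : ℕ} {s : Fin k → X × X} (h : IsExt s) :
    Function.Injective fun t => (s t).1 :=
  fun t u htu => le_antisymm (h.1 t u htu.le) (h.1 u t (Eq.ge htu))

variable [Fintype X]

/-- In a linear extension, an element is minimal among the remaining ones at step t iff it is not
listed before t and everything strictly below it is; `Defect` spells this out for j. An upper bound
of the t-th element is never listed before t, so the chosen element remains automatically. -/
theorem isGood_iff (ρ : X → ℕ) {s : Fin (Fintype.card X) → X × X} :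
    IsGood ρ Set.univ s ↔ IsExt s ∧ ¬ Defect ρ s := by
  constructor
  · intro h
    have hmem (t) : (s t).1 ∈ remaining Set.univ s t := (h t).2.1.prop
    have hinj : Function.Injective fun t => (s t).1 := by
      intro t u htu
      rcases lt_trichotomy t u with hlt | rfl | hlt
      · exact absurd htu ((hmem u).2 t hlt)
      · rfl
      · exact absurd htu.symm ((hmem t).2 u hlt)
    refine ⟨⟨fun t u htu => ?_, fun t => (h t).2.2.1⟩, ?_⟩
    · by_contra! hlt
      -- An element listed too late would still remain at step u, contradicting minimality of the
      -- one removed there.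
      have hle := (h u).2.1.2 (y := (s t).1) ⟨trivial, fun v hv => (hmem t).2 v (hv.trans hlt)⟩ htu
      exact hlt.ne' (hinj (le_antisymm htu hle))
    · rintro ⟨t, j, hj, hjy, h1, h2⟩
      refine hj.not_ge ((h t).2.2.2 j ⟨⟨trivial, fun u hu huj => hu.not_ge (h1 u huj)⟩, ?_⟩ hjy)
      intro z hz hzj
      by_contra hjz
      obtain ⟨u, rfl⟩ := surjective_of_injective hinj z
      exact hz.2 u (h2 u (lt_of_le_not_ge hzj hjz)) rfl
  · rintro ⟨h, hd⟩ t
    have hmem : (s t).1 ∈ remaining Set.univ s t :=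
      ⟨trivial, fun u hu hut => hu.not_ge (h.1 t u hut.ge)⟩
    refine ⟨⟨trivial, fun u hu hut => hu.not_ge (h.1 t u (hut ▸ h.2 t))⟩, ⟨hmem, ?_⟩, h.2 t, ?_⟩
    · intro z hz hzt
      obtain ⟨u, rfl⟩ := surjective_of_injective h.injective z
      rcases (h.1 u t hzt).lt_or_eq with hlt | rfl
      · exact absurd rfl (hz.2 u hlt)
      · exact le_rfl
    · intro j hj hjy
      by_contra! hlt
      refine hd ⟨t, j, hlt, hjy, fun u hu => ?_, fun u hu => ?_⟩
      · by_contra! hut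
        exact hj.prop.2 u hut hu
      · by_contra! htu
        exact hu.not_ge (hj.2 ⟨trivial, fun v hv hvu => by
          have := h.injective hvu
          omega⟩ hu.le)

/-- The sequences fibre over linear extensions; each fibre is a product of upper ideals indexed by
places, which the extension re-indexes by elements. -/
theorem card_isExt :
    Nat.card {s : Fin (Fintype.card X) → X × X // IsExt s} =
      numLinExt X * ∏ x : X, upperCard x := by
  let F : (Σ f : {f : X ≃ Fin (Fintype.card X) // ∀ x y : X, x < y → f x < f y},
      ∀ t, {y : X // f.1.symm t ≤ y}) → {s : Fin (Fintype.card X) → X × X // IsExt s} :=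
    fun a => ⟨fun t => (a.1.1.symm t, (a.2 t : X)), fun t u htu => by
      rcases htu.lt_or_eq with h | h
      · simpa using (a.1.2 _ _ h).le
      · exact (a.1.1.symm.injective h).le, fun t => (a.2 t).2⟩
  have hF : F.Bijective := by
    constructor
    · rintro ⟨⟨f, hf⟩, g⟩ ⟨⟨f', hf'⟩, g'⟩ h
      have h (t) := congrFun (congrArg Subtype.val h) t
      obtain rfl : f = f' := Equiv.symm_bijective.injective
        (Equiv.ext fun t => (Prod.mk.inj (h t)).1)
      obtain rfl : g = g' := funext fun t => Subtype.ext (Prod.mk.inj (h t)).2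
      rfl
    · rintro ⟨s, hs⟩
      let f := (Equiv.ofBijective (fun t => (s t).1)
        ⟨hs.injective, surjective_of_injective hs.injective⟩).symm
      have hsymm (t) : f.symm t = (s t).1 := rfl
      refine ⟨⟨⟨f, fun x y hxy => ?_⟩, fun t => ⟨(s t).2, hs.2 t⟩⟩, rfl⟩
      have hx := hsymm (f x)
      have hy := hsymm (f y)
      rw [Equiv.symm_apply_apply] at hx hy
      refine lt_of_le_of_ne (hs.1 _ _ (hx ▸ hy ▸ hxy.le)) fun h => hxy.ne (f.injective h)
  have := Fintype.ofFinite {f : X ≃ Fin (Fintype.card X) // ∀ x y : X, x < y → f x < f y}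
  rw [← Nat.card_congr (Equiv.ofBijective F hF), Nat.card_sigma]
  have hc (f : {f : X ≃ Fin (Fintype.card X) // ∀ x y : X, x < y → f x < f y}) :
      Nat.card (∀ t, {y : X // f.1.symm t ≤ y}) = ∏ x : X, upperCard x := by
    rw [Nat.card_pi]
    exact f.1.symm.prod_comp fun x => upperCard x
  simp only [hc, Finset.sum_const, Finset.card_univ, smul_eq_mul, numLinExt]
  rw [← Nat.card_eq_fintype_card]

theorem ncard_isExt_defect {ρ : X → ℕ} (hρ : ρ.Injective) :
    ({s : Fin (Fintype.card X) → X × X | IsExt s ∧ Defect ρ s}.ncard : ℤ) = xi X := by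
  have h1 : {s : Fin (Fintype.card X) → X × X | IsExt s}.ncard =
      numLinExt X * ∏ x : X, upperCard x := card_isExt
  have h2 : {s : Fin (Fintype.card X) → X × X | IsExt s ∧ ¬ Defect ρ s}.ncard =
      (Fintype.card X)! := by
    simp only [← isGood_iff]
    exact card_isGood hρ _ _ (by simp)
  have h3 := Set.ncard_inter_add_ncard_sdiff_eq_ncard
    {s : Fin (Fintype.card X) → X × X | IsExt s} {s | Defect ρ s}
  rw [xi, ← h1, ← h2]
  rw [← h3]
  push_cast
  exact (add_sub_cancel_right _ _).symm

end LinExt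

/-! ### Certificates and sequences -/

namespace LinExt

open List

variable {X : Type} {n : ℕ} {ε : X ≃ Fin n} {M S T : ℕ → ℕ → Prop}
  {s : Fin n → X × X}

/-- The graphs of the two components of a sequence. -/
def HasGraphs (ε : X ≃ Fin n) (S T : ℕ → ℕ → Prop) (s : Fin n → X × X) : Prop :=
  (∀ t i : Fin n, S t i ↔ ε (s t).1 = i) ∧ ∀ t i : Fin n, T t i ↔ ε (s t).2 = i

theorem isGraph_of_forall {f : Fin n → Fin n} (h : ∀ t i : Fin n, S t i ↔ f t = i) :
    IsGraph n S := fun t ht =>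
  ⟨f ⟨t, ht⟩, (f ⟨t, ht⟩).2, (h ⟨t, ht⟩ _).2 rfl, fun j hj hS =>
    congrArg Fin.val ((h ⟨t, ht⟩ ⟨j, hj⟩).1 hS).symm⟩

theorem exists_forall_of_isGraph (h : IsGraph n S) :
    ∃ f : Fin n → Fin n, ∀ t i : Fin n, S t i ↔ f t = i := by
  choose f hf hS huniq using h
  refine ⟨fun t => ⟨f t t.2, hf t t.2⟩, fun t i =>
    ⟨fun hi => Fin.ext (huniq t t.2 i i.2 hi).symm, ?_⟩⟩
  rintro rfl
  exact hS t t.2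

theorem exists_hasGraphs_iff :
    (∃ s, HasGraphs ε S T s) ↔ IsGraph n S ∧ IsGraph n T := by
  constructor
  · rintro ⟨s, h1, h2⟩
    exact ⟨isGraph_of_forall h1, isGraph_of_forall h2⟩
  · rintro ⟨h1, h2⟩
    obtain ⟨f, hf⟩ := exists_forall_of_isGraph h1
    obtain ⟨g, hg⟩ := exists_forall_of_isGraph h2
    exact ⟨fun t => (ε.symm (f t), ε.symm (g t)), by simpa using hf, by simpa using hg⟩

theorem eq_of_getElem?_eq_true {l l' : List Bool} (h : l.length = l'.length)
    (h' : ∀ k < l.length, l[k]? = some true ↔ l'[k]? = some true) : l = l' := by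
  refine List.ext_getElem h fun k hk hk' => ?_
  have := h' k hk
  rw [List.getElem?_eq_getElem hk, List.getElem?_eq_getElem hk', Option.some_inj,
    Option.some_inj] at this
  exact Bool.eq_iff_iff.2 this

theorem mul_add_lt (t i : Fin n) : (t : ℕ) * n + i < n * n := by
  have := Nat.mul_le_mul_right n (Nat.succ_le_of_lt t.2)
  have := i.2
  rw [Nat.succ_mul] at *
  omega

theorem exists_mul_add {k : ℕ} (hk : k < n * n) : ∃ t i : Fin n, k = (t : ℕ) * n + i := by
  have hn : 0 < n := Nat.pos_of_ne_zero (by rintro rfl; simp at hk)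
  exact ⟨⟨k / n, Nat.div_lt_of_lt_mul hk⟩, ⟨k % n, Nat.mod_lt _ hn⟩,
    (Nat.div_add_mod' k n).symm⟩

theorem mul_add_inj {t i t' i' : Fin n} (h : (t : ℕ) * n + i = t' * n + i') :
    t = t' ∧ i = i' := by
  have hn : 0 < n := t.pos
  have h1 := congrArg (· / n) h
  have h2 := congrArg (· % n) h
  simp only [Nat.mul_add_mod_of_lt i.2, Nat.mul_add_mod_of_lt i'.2] at h2
  simp only [mul_comm _ n, Nat.mul_add_div hn, Nat.div_eq_of_lt i.2, Nat.div_eq_of_lt i'.2] at h1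
  exact ⟨Fin.ext h1, Fin.ext h2⟩

theorem divNat_mul_add (t i : Fin n) :
    Fin.divNat (⟨t * n + i, mul_add_lt t i⟩ : Fin (n * n)) = t :=
  (mul_add_inj (t := Fin.divNat ⟨t * n + i, mul_add_lt t i⟩)
    (i := Fin.modNat ⟨t * n + i, mul_add_lt t i⟩) (Nat.div_add_mod' _ _)).1

theorem modNat_mul_add (t i : Fin n) :
    Fin.modNat (⟨t * n + i, mul_add_lt t i⟩ : Fin (n * n)) = i :=
  (mul_add_inj (t := Fin.divNat ⟨t * n + i, mul_add_lt t i⟩)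
    (i := Fin.modNat ⟨t * n + i, mul_add_lt t i⟩) (Nat.div_add_mod' _ _)).2

/-- The size is the position of the first bit that is not one. -/
theorem eq_of_isMatrixCode {m : ℕ} {x : List Bool} (h : IsMatrixCode n x)
    (h' : IsMatrixCode m x) : n = m := by
  rcases lt_trichotomy n m with hlt | heq | hlt
  · exact absurd (h'.2.1 n hlt) h.2.2
  · exact heq
  · exact absurd (h.2.1 m hlt) h'.2.2

/-- The string `y` describes the sequence `s`. -/
def Describes (ε : X ≃ Fin n) (y : List Bool) (s : Fin n → X × X) : Prop :=
  HasGraphs ε (Entry y 0 n) (Entry y (n * n) n) s ∧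
    ∀ k < y.length, n * n + n * n ≤ k → ¬ y[k]? = some true

/-- The bits of the two graphs are forced by `s` and the padding is forced to be zero, so no
certificate is counted twice. -/
theorem Describes.unique_left {y y' : List Bool} (h : Describes ε y s) (h' : Describes ε y' s)
    (hl : y.length = y'.length) : y = y' := by
  refine eq_of_getElem?_eq_true hl fun k hk => ?_
  rcases lt_or_ge k (n * n) with h1 | h1
  · obtain ⟨t, i, rfl⟩ := exists_mul_add h1
    have := (h.1.1 t i).trans (h'.1.1 t i).symm
    simpa only [Entry, zero_add] using this
  rcases lt_or_ge k (n * n + n * n) with h2 | h2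
  · obtain ⟨t, i, hti⟩ := exists_mul_add (n := n) (k := k - n * n) (by omega)
    have hk' : k = n * n + t * n + i := by omega
    have := (h.1.2 t i).trans (h'.1.2 t i).symm
    simpa only [Entry, ← hk'] using this
  · exact iff_of_false (h.2 k hk h2) (h'.2 k (hl ▸ hk) h2)

theorem Describes.unique_right {y : List Bool} {s' : Fin n → X × X} (h : Describes ε y s)
    (h' : Describes ε y s') : s = s' :=
  funext fun t => Prod.ext (ε.injective ((h'.1.1 t _).1 ((h.1.1 t _).2 rfl)).symm)
    (ε.injective ((h'.1.2 t _).1 ((h.1.2 t _).2 rfl)).symm)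

open Classical in
theorem exists_describes (ε : X ≃ Fin n) (s : Fin n → X × X) {l : ℕ} (hl : n * n + n * n ≤ l) :
    ∃ y : List Bool, y.length = l ∧ Describes ε y s := by
  let P : ℕ → Prop := fun k => (∃ t : Fin n, k = t * n + ε (s t).1) ∨
    ∃ t : Fin n, k = n * n + t * n + ε (s t).2
  let y := List.ofFn fun k : Fin l => decide (P k)
  have hy {k : ℕ} (hk : k < l) : y[k]? = some true ↔ P k := by
    simp [y, hk]
  refine ⟨y, by simp [y], ⟨fun t i => ?_, fun t i => ?_⟩, fun k hk hk' => ?_⟩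
  · have hlt := mul_add_lt t i
    rw [Entry, zero_add, hy (by omega)]
    constructor
    · rintro (⟨u, hu⟩ | ⟨u, hu⟩)
      · obtain ⟨rfl, rfl⟩ := mul_add_inj hu
        rfl
      · omega
    · rintro rfl
      exact .inl ⟨t, rfl⟩
  · have hlt := mul_add_lt t i
    rw [Entry, hy (by omega)]
    constructor
    · rintro (⟨u, hu⟩ | ⟨u, hu⟩)
      · have := mul_add_lt u (ε (s u).1)
        omega
      · obtain ⟨rfl, rfl⟩ := mul_add_inj (n := n) (t := t) (i := i) (t' := u) (i' := ε (s u).2)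
          (by omega)
        rfl
    · rintro rfl
      exact .inr ⟨t, rfl⟩
  · rw [hy (by simpa [y] using hk)]
    rintro (⟨u, hu⟩ | ⟨u, hu⟩)
    · have := mul_add_lt u (ε (s u).1)
      omega
    · have := mul_add_lt u (ε (s u).2)
      omega

/-! ### The verifier's formulas and the poset encoding -/

variable [PartialOrder X]

theorem HasGraphs.isExtension_iff (h : HasGraphs ε S T s)
    (hM : ∀ a b, M (ε a) (ε b) ↔ a ≤ b) : IsExtension n M S T ↔ IsExt s := by
  obtain ⟨hS, hT⟩ := h
  constructor
  · rintro ⟨h1, h2⟩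
    exact ⟨fun t u htu => h1 t t.2 u u.2 _ (ε _).2 _ (ε _).2 ((hS t _).2 rfl) ((hS u _).2 rfl)
      ((hM _ _).2 htu), fun t => (hM _ _).1 (h2 t t.2 _ (ε _).2 _ (ε _).2 ((hS t _).2 rfl)
      ((hT t _).2 rfl))⟩
  · rintro ⟨h1, h2⟩
    constructor
    · intro t ht u hu i hi j hj hti huj hij
      have hi' := (hS ⟨t, ht⟩ ⟨i, hi⟩).1 hti
      have hj' := (hS ⟨u, hu⟩ ⟨j, hj⟩).1 huj
      refine h1 ⟨t, ht⟩ ⟨u, hu⟩ ((hM _ _).1 ?_)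
      rwa [hi', hj']
    · intro t ht i hi k hk hti htk
      have hi' := (hS ⟨t, ht⟩ ⟨i, hi⟩).1 hti
      have hk' := (hT ⟨t, ht⟩ ⟨k, hk⟩).1 htk
      have := (hM _ _).2 (h2 ⟨t, ht⟩)
      rwa [hi', hk'] at this

theorem HasGraphs.hasDefect_iff (h : HasGraphs ε S T s)
    (hM : ∀ a b, M (ε a) (ε b) ↔ a ≤ b) :
    HasDefect n M S T ↔ Defect (fun a => (ε a : ℕ)) s := by
  obtain ⟨hS, hT⟩ := h
  constructor
  · rintro ⟨t, ht, i, hi, j, hj, k, hk, hti, htk, hji, hjk, h1, h2⟩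
    have hi' := (hS ⟨t, ht⟩ ⟨i, hi⟩).1 hti
    have hk' := (hT ⟨t, ht⟩ ⟨k, hk⟩).1 htk
    obtain ⟨a, ha⟩ := ε.surjective ⟨j, hj⟩
    refine ⟨⟨t, ht⟩, a, ?_, (hM _ _).1 ?_, fun u hu => ?_, fun u hu => ?_⟩
    · simpa only [hi', ha] using hji
    · rwa [hk', ha]
    · exact h1 u u.2 ((hS u ⟨j, hj⟩).2 (by rw [hu, ha]))
    · refine h2 u u.2 _ (ε (s u).1).2 ((hS u _).2 rfl) ?_ ?_
      · have := (hM _ _).2 hu.le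
        rwa [ha] at this
      · intro he
        exact hu.ne (ε.injective (Fin.ext (by rw [ha, he])))
  · rintro ⟨t, a, h1, h2, h3, h4⟩
    refine ⟨t, t.2, _, (ε (s t).1).2, _, (ε a).2, _, (ε (s t).2).2, (hS t _).2 rfl,
      (hT t _).2 rfl, h1, (hM _ _).2 h2, fun u hu hua => ?_, fun u hu l hl hul hla hne => ?_⟩
    · exact h3 ⟨u, hu⟩ (ε.injective ((hS ⟨u, hu⟩ (ε a)).1 hua))
    · have hl' := (hS ⟨u, hu⟩ ⟨l, hl⟩).1 hul
      refine h4 ⟨u, hu⟩ (lt_of_le_of_ne ((hM _ _).1 ?_) ?_)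
      · rwa [hl']
      · rintro rfl
        exact hne (congrArg Fin.val hl'.symm)

theorem isOrder_iff : IsOrder n M ↔
    ∃ h : PartialOrder (Fin n), ∀ a b : Fin n, M a b ↔ h.le a b := by
  constructor
  · rintro ⟨h1, h2, h3⟩
    exact ⟨{ le := fun a b => M a b
             lt := fun a b => M a b ∧ ¬ M b a
             lt_iff_le_not_ge := fun _ _ => Iff.rfl
             le_refl := fun a => h1 a a.2
             le_trans := fun a b c => h3 a a.2 b b.2 c c.2
             le_antisymm := fun a b h h' => Fin.ext (h2 a a.2 b b.2 h h') }, fun a b => Iff.rfl⟩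
  · rintro ⟨h, hM⟩
    refine ⟨fun i hi => (hM ⟨i, hi⟩ ⟨i, hi⟩).2 (h.le_refl _), fun i hi j hj hij hji => ?_,
      fun i hi j hj k hk hij hjk => (hM ⟨i, hi⟩ ⟨k, hk⟩).2 (h.le_trans _ ⟨j, hj⟩ _
        ((hM ⟨i, hi⟩ ⟨j, hj⟩).1 hij) ((hM ⟨j, hj⟩ ⟨k, hk⟩).1 hjk))⟩
    exact congrArg Fin.val (h.le_antisymm ⟨i, hi⟩ ⟨j, hj⟩ ((hM _ _).1 hij) ((hM _ _).1 hji))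

theorem isOrder_of_forall (hM : ∀ a b, M (ε a) (ε b) ↔ a ≤ b) : IsOrder n M :=
  isOrder_iff.2 ⟨PartialOrder.lift ε.symm ε.symm.injective, fun a b => by
    have := hM (ε.symm a) (ε.symm b)
    rwa [Equiv.apply_symm_apply, Equiv.apply_symm_apply] at this⟩

open Classical in
theorem encodePoset_eq (ε : X ≃ Fin n) : encodePoset ε =
    List.replicate n true ++ false :: List.ofFn fun k : Fin (n * n) =>
      decide (ε.symm k.divNat ≤ ε.symm k.modNat) := by
  rw [encodePoset, List.ofFn_mul]
  congr 2
  rw [List.flatMap_def, ← List.ofFn_eq_map]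
  congr 2
  funext i
  rw [← List.ofFn_eq_map]
  congr 1
  funext j
  rw [divNat_mul_add, modNat_mul_add]

theorem isMatrixCode_encodePoset (ε : X ≃ Fin n) : IsMatrixCode n (encodePoset ε) := by
  rw [encodePoset_eq]
  refine ⟨by simp; omega, fun j hj => ?_, ?_⟩
  · rw [List.getElem?_append_left (by simpa using hj)]
    simp [hj]
  · simp

theorem entry_encodePoset (ε : X ≃ Fin n) (a b : X) :
    Entry (encodePoset ε) (n + 1) n (ε a) (ε b) ↔ a ≤ b := by
  rw [encodePoset_eq, Entry, List.getElem?_append_right (by simp; omega),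
    List.length_replicate, show n + 1 + (ε a : ℕ) * n + ε b - n = (ε a : ℕ) * n + ε b + 1 by omega,
    List.getElem?_cons_succ, List.getElem?_ofFn, dif_pos (mul_add_lt _ _)]
  rw [divNat_mul_add, modNat_mul_add]
  simp

/-- Size and order relation determine every bit; this is why a string with any certificate must be a
poset code. -/
theorem eq_encodePoset {x : List Bool} (hx : IsMatrixCode n x)
    (hM : ∀ a b, Entry x (n + 1) n (ε a) (ε b) ↔ a ≤ b) : x = encodePoset ε := by
  obtain ⟨h1, h2, h3⟩ := hx
  obtain ⟨h1', h2', h3'⟩ := isMatrixCode_encodePoset ε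
  refine eq_of_getElem?_eq_true (h1.trans h1'.symm) fun k hk => ?_
  rcases lt_trichotomy k n with h | rfl | h
  · simp [h2 k h, h2' k h]
  · simp [h3, h3']
  · obtain ⟨t, i, hti⟩ := exists_mul_add (n := n) (k := k - (n + 1)) (by omega)
    have hk' : k = n + 1 + t * n + i := by omega
    have h := (hM (ε.symm t) (ε.symm i)).trans (entry_encodePoset ε _ _).symm
    simpa only [Entry, Equiv.apply_symm_apply, ← hk'] using h

theorem isPosetCode_of_certifies {x y : List Bool} (h : Certifies x y) : IsPosetCode x := by
  obtain ⟨n, -, hx, hM, -⟩ := h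
  obtain ⟨h, hM⟩ := isOrder_iff.1 hM
  exact ⟨Fin n, h, n, Equiv.refl _, letI := h; eq_encodePoset (ε := Equiv.refl (Fin n)) hx hM⟩

theorem certifies_encodePoset_iff {y : List Bool} :
    Certifies (encodePoset ε) y ↔
      ∃ s : Fin n → X × X, Describes ε y s ∧ IsExt s ∧ Defect (fun a => (ε a : ℕ)) s := by
  have hx := isMatrixCode_encodePoset ε
  have hM := entry_encodePoset ε
  constructor
  · rintro ⟨m, -, hm, -, ⟨hS, hT, hy⟩, h1, h2⟩
    -- The size guessed by the verifier must be the true one.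
    obtain rfl := eq_of_isMatrixCode hx hm
    obtain ⟨s, hs⟩ := (exists_hasGraphs_iff (ε := ε)).2 ⟨hS, hT⟩
    exact ⟨s, ⟨hs, hy⟩, (hs.isExtension_iff hM).1 h1, (hs.hasDefect_iff hM).1 h2⟩
  · rintro ⟨s, ⟨hs, hy⟩, h1, h2⟩
    obtain ⟨hS, hT⟩ := exists_hasGraphs_iff.1 ⟨s, hs⟩
    exact ⟨n, by rw [hx.1]; omega, hx, isOrder_of_forall hM, ⟨hS, hT, hy⟩,
      (hs.isExtension_iff hM).2 h1, (hs.hasDefect_iff hM).2 h2⟩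

theorem ncard_certifies_encodePoset (ε : X ≃ Fin n) :
    {y : List Bool | y.length = 2 * (encodePoset ε).length ∧ Certifies (encodePoset ε) y}.ncard =
      {s : Fin n → X × X | IsExt s ∧ Defect (fun a => (ε a : ℕ)) s}.ncard := by
  -- The length is 2(n + 1 + n²), which leaves room for two n × n matrices.
  choose f hf hd using fun s => exists_describes ε s (l := 2 * (encodePoset ε).length)
    (by rw [(isMatrixCode_encodePoset ε).1]; omega)
  have hinj : f.Injective := fun s s' h => (hd s).unique_right (h ▸ hd s')
  rw [← Set.ncard_image_of_injective _ hinj]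
  congr 1
  ext y
  simp only [Set.mem_ofPred_eq, certifies_encodePoset_iff, Set.mem_image]
  constructor
  · rintro ⟨hy, s, hs, h⟩
    exact ⟨s, h, (hd s).unique_left hs ((hf s).trans hy.symm)⟩
  · rintro ⟨s, h, rfl⟩
    exact ⟨hf s, s, hd s, h⟩

end LinExt

theorem theoremt :
    ∃ F : List Bool → ℕ, InSharpP F ∧
      (∀ (X : Type) [PartialOrder X] [Fintype X] (n : ℕ) (ε : X ≃ Fin n),
        (F (encodePoset ε) : ℤ) = xi X) ∧
      ∀ w : List Bool, ¬ IsPosetCode w → F w = 0 := by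
  refine ⟨fun x => {y : List Bool | y.length = 2 * x.length ∧ Certifies x y}.ncard,
    ⟨2 * Polynomial.X, _,
      CounterMachine.compPred_certifies.polyTimeDecidable, fun x => by simp⟩, ?_, ?_⟩
  · intro X _ _ n ε
    obtain rfl : n = Fintype.card X := by simpa using (Fintype.card_congr ε).symm
    dsimp only
    rw [LinExt.ncard_certifies_encodePoset]
    -- Elements are ranked by the listing `ε`: the set of certificates depends on it, their number
    -- does not.
    exact LinExt.ncard_isExt_defect (Fin.val_injective.comp ε.injective)
  · intro w hw
    have : {y : List Bool | y.length = 2 * w.length ∧ Certifies w y} = ∅ :=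
      Set.eq_empty_of_forall_notMem fun y hy => hw (LinExt.isPosetCode_of_certifies hy.2)
    simp [this]
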